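/- Let $L\ge 1$ and consider a linear convolutional network of stride one with filter sizes $\boldsymbol k=(k_1,\dots,k_L)$, $k_l\ge 1$, and layer dimensions $d_0,\dots,d_L\ge 1$, $d_l=d_{l-1}-k_l+1$. A filter $w\in\mathbb R^{m}$ defines the stride-one convolutional matrices (row $i$, $i\ge 0$, carries $w_0,\dots,w_{m-1}$ in columns $i,\dots,i+m-1$ and zeros elsewhere). The parameterization map $\mu$ sends $\theta=(w_1,\dots,w_L)\in\mathbb R^{k_1}\times\cdots\times\mathbb R^{k_L}$ to the product $\overline W=W_L\cdots W_1\in\mathbb R^{d_L\times d_0}$ of the convolutional matrices $W_l\in\mathbb R^{d_l\times d_{l-1}}$ with filters $w_l$; this is again a convolutional matrix, with a filter $\overline w\in\mathbb R^k$, $k-1=\sum_l (k_l-1)$, and we identify $\overline W$ with $\overline w$. For data $X\in\mathbb R^{d_0\times N}$, $Y\in\mathbb R^{d_L\times N}$ let $\ell(\overline w)=\|\overline W X-Y\|^2$ (squared Frobenius norm) and $\mathcal L=\ell\circ\mu$, and let $\mathrm{Crit}(\mathcal L)$ be the set of parameters $\theta$ at which all partial derivatives of $\mathcal L$ vanish.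 Identify $w\in\mathbb R^k$ with the binary form $\pi(w)=\sum_{i=0}^{k-1} w_i\,\mathsf x^{k-1-i}\mathsf y^i\in\mathbb R[\mathsf x,\mathsf y]_{k-1}$. Let $(\rho\mid\gamma)=(\rho_1,\dots,\rho_r\mid\gamma_1,\dots,\gamma_c)$ be positive integers with $\sum_i\rho_i+2\sum_j\gamma_j=k-1$, and put $\lambda=\lambda_{\rho|\gamma}=(\rho_1,\dots,\rho_r,\gamma_1,\gamma_1,\dots,\gamma_c,\gamma_c)$. * A form $P\in\mathbb R[\mathsf x,\mathsf y]_{k-1}$ has real root multiplicity pattern $(\rho\mid\gamma)$ if $P=a\,p_1^{\rho_1}\cdots p_r^{\rho_r}q_1^{\gamma_1}\cdots q_c^{\gamma_c}$ with $a\in\mathbb R\setminus\{0\}$ and real forms $p_i$ of degree $1$ and $q_j$ of degree $2$ that are irreducible and pairwise linearly independent. * The multiple root locus $\Delta_\lambda\subset\mathbb R[\mathsf x,\mathsf y]_{k-1}$ is the set of real forms $P=a\prod_i Q_i^{\lambda_i}$ with $a\in\mathbb C$ and complex linear forms $Q_i$. * $\mathrm{Crit}(\ell|_{\pi^{-1}(\Delta_\lambda)})$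 is the set of smooth points $\overline w$ of $\pi^{-1}(\Delta_\lambda)$ (points near which the set is a smooth embedded submanifold of $\mathbb R^k$) such that the differential $d\ell(\overline w)$ vanishes on the tangent space $T_{\overline w}\,\pi^{-1}(\Delta_\lambda)$. * $(\rho\mid\gamma)$ is compatible with the architecture if $\rho_i$ balls of size $1$ and color $i$ ($1\le i\le r$) and $\gamma_j$ balls of size $2$ and color $r+j$ ($1\le j\le c$) can be placed into $L$ bins of sizes $k_1-1,\dots,k_L-1$ such that no bin contains two balls of the same color. Assume $N\ge d_0$. Then the following holds for generic data $(X,Y)$, i.e. for all $(X,Y)$ outside the zero set of some nonzero real polynomial in the entries of $X$ and $Y$ (depending only on the architecture and $N$). For every $(\rho\mid\gamma)$ as above: 1. If $(\rho\mid\gamma)$ is compatible with the architecture, then for every $\overline w\in\mathrm{Crit}(\ell|_{\pi^{-1}(\Delta_\lambda)})$ such that $\pi(\overline w)$ has real root multiplicity pattern $(\rho\mid\gamma)$ there is some $\theta\in\mu^{-1}(\overline w)\cap\mathrm{Crit}(\mathcal L)$. 2. Otherwise, every $\overline w\in\mathrm{Crit}(\ell|_{\pi^{-1}(\Delta_\lambda)})$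 such that $\pi(\overline w)$ has real root multiplicity pattern $(\rho\mid\gamma)$ satisfies $\mu^{-1}(\overline w)\cap\mathrm{Crit}(\mathcal L)=\emptyset$. -/

import Mathlib

open scoped ContDiff

noncomputable section

namespace LCN

/-! ### Linear convolutional networks of stride one -/

/-- The `m × n` convolutional matrix of stride one with filter `w`:
its entry in row `i` and column `j` is `w t` if `j = i + t`, and `0` if there is no such `t`. -/
def convMatrix {m n k : ℕ} (w : Fin k → ℝ) : Matrix (Fin m) (Fin n) ℝ :=
  fun i j => ∑ t : Fin k, if (j : ℕ) = (i : ℕ) + (t : ℕ) then w t else 0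

/-- The parameter space `ℝ^{k₁} × ⋯ × ℝ^{k_L}` of an `L`-layer network. -/
abbrev Params {L : ℕ} (k : Fin L → ℕ) : Type := (l : Fin L) → Fin (k l) → ℝ

/-- The product `W_m ⋯ W_1` of the convolutional matrices of the first `m` layers; the filter
`θ l` belongs to the layer that maps dimension `d l.castSucc` to dimension `d l.succ`. -/
def partialProduct {L : ℕ} (d : Fin (L + 1) → ℕ) (k : Fin L → ℕ) (θ : Params k)
    (m : Fin (L + 1)) : Matrix (Fin (d m)) (Fin (d 0)) ℝ :=
  Fin.induction (motive := fun m => Matrix (Fin (d m)) (Fin (d 0)) ℝ)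
    1 (fun l M => convMatrix (θ l) * M) m

/-- The parameterization map `μ : θ ↦ W_L ⋯ W_1`. -/
def paramMap {L : ℕ} (d : Fin (L + 1) → ℕ) (k : Fin L → ℕ) (θ : Params k) :
    Matrix (Fin (d (Fin.last L))) (Fin (d 0)) ℝ :=
  partialProduct d k θ (Fin.last L)

/-- The degree `∑ (k_l - 1)` of the polynomial of an end-to-end filter; the end-to-end filter
itself has `endDegree k + 1` entries. -/
def endDegree {L : ℕ} (k : Fin L → ℕ) : ℕ := ∑ l, (k l - 1)

/-- The square loss `‖V X - Y‖²` (squared Frobenius norm) of a matrix `V`. -/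
def squareLoss {m n N : ℕ} (X : Matrix (Fin n) (Fin N) ℝ) (Y : Matrix (Fin m) (Fin N) ℝ)
    (V : Matrix (Fin m) (Fin n) ℝ) : ℝ :=
  ∑ i, ∑ j, ((V * X - Y) i j) ^ 2

/-- The square loss in function space, as a function of the filter of a convolutional matrix. -/
def filterLoss {m n N K : ℕ} (X : Matrix (Fin n) (Fin N) ℝ) (Y : Matrix (Fin m) (Fin N) ℝ)
    (w : Fin K → ℝ) : ℝ :=
  squareLoss X Y (convMatrix w)

/-- The square loss in parameter space. -/
def paramLoss {L N : ℕ} (d : Fin (L + 1) → ℕ) (k : Fin L → ℕ)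
    (X : Matrix (Fin (d 0)) (Fin N) ℝ) (Y : Matrix (Fin (d (Fin.last L))) (Fin N) ℝ)
    (θ : Params k) : ℝ :=
  squareLoss X Y (paramMap d k θ)

/-- `p` is a critical point of `f`. -/
def IsCritical {E : Type*} [NormedAddCommGroup E] [NormedSpace ℝ E] (f : E → ℝ) (p : E) : Prop :=
  HasFDerivAt f (0 : E →L[ℝ] ℝ) p

/-- A property holds for generic data `(X, Y)`: there is a nonzero real polynomial in the entries
of `X` and `Y` such that the property holds wherever this polynomial does not vanish. -/
def ForGenericData (m n N : ℕ)
    (Q : Matrix (Fin n) (Fin N) ℝ → Matrix (Fin m) (Fin N) ℝ → Prop) : Prop :=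
  ∃ F : MvPolynomial ((Fin n × Fin N) ⊕ (Fin m × Fin N)) ℝ, F ≠ 0 ∧
    ∀ (X : Matrix (Fin n) (Fin N) ℝ) (Y : Matrix (Fin m) (Fin N) ℝ),
      MvPolynomial.eval (Sum.elim (fun a => X a.1 a.2) (fun b => Y b.1 b.2)) F ≠ 0 → Q X Y

/-! ### Binary forms, multiple root loci and real root multiplicity patterns -/

/-- The binary form `w₀ x^n + w₁ x^(n-1) y + ⋯ + w_n y^n` of a filter with `n + 1` entries. -/
def filterPoly {n : ℕ} (w : Fin (n + 1) → ℝ) : MvPolynomial (Fin 2) ℝ :=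
  ∑ i : Fin (n + 1),
    MvPolynomial.C (w i) * MvPolynomial.X 0 ^ (n - (i : ℕ)) * MvPolynomial.X 1 ^ (i : ℕ)

/-- The multiple root locus `Δ_lam`: the real binary forms of degree `∑ lam i` that are, up to a
scalar, of the form `∏ Q_i ^ lam_i` with complex linear forms `Q_i`. (The scalar can be absorbed
into the `Q_i`, except for forms of degree `0`, where the locus consists of all constants.) -/
def multipleRootLocus {ι : Type} [Fintype ι] (lam : ι → ℕ) : Set (MvPolynomial (Fin 2) ℝ) :=
  {P | P.IsHomogeneous (∑ i, lam i) ∧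
    ∃ (a : ℂ) (Q : ι → MvPolynomial (Fin 2) ℂ), (∀ i, (Q i).IsHomogeneous 1) ∧
      MvPolynomial.map (algebraMap ℝ ℂ) P = MvPolynomial.C a * ∏ i, Q i ^ lam i}

/-- The partition `(ρ₁, …, ρ_r, γ₁, γ₁, …, γ_c, γ_c)` of a pattern `(ρ | γ)`. -/
def patternPartition {r c : ℕ} (ρ : Fin r → ℕ) (γ : Fin c → ℕ) : Fin r ⊕ (Fin c ⊕ Fin c) → ℕ :=
  Sum.elim ρ (Sum.elim γ γ)

/-- `P` has real root multiplicity pattern `(ρ | γ)`: up to a nonzero real scalar, `P` is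
`p₁^ρ₁ ⋯ p_r^ρ_r q₁^γ₁ ⋯ q_c^γ_c` with real linear forms `p_i` and real quadratic forms `q_j`
that are irreducible and pairwise linearly independent. -/
def HasRrmp {r c : ℕ} (ρ : Fin r → ℕ) (γ : Fin c → ℕ) (P : MvPolynomial (Fin 2) ℝ) : Prop :=
  ∃ (a : ℝ) (p : Fin r → MvPolynomial (Fin 2) ℝ) (q : Fin c → MvPolynomial (Fin 2) ℝ),
    a ≠ 0 ∧
    (∀ i, (p i).IsHomogeneous 1 ∧ Irreducible (p i)) ∧
    (∀ j, (q j).IsHomogeneous 2 ∧ Irreducible (q j)) ∧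
    (Pairwise fun s t : Fin r ⊕ Fin c =>
      LinearIndependent ℝ ![Sum.elim p q s, Sum.elim p q t]) ∧
    P = MvPolynomial.C a * (∏ i, p i ^ ρ i) * ∏ j, q j ^ γ j

/-- `(ρ | γ)` is compatible with the filter sizes `k`: one can place `ρ i` balls of size 1 and
colour `i` (for each `i`) and `γ j` balls of size 2 and colour `r + j` (for each `j`) into bins of
sizes `k l - 1` such that no bin contains two balls of the same colour. Here `f i n` and `g j n`
are the bins that receive the `n`-th ball of the respective colour. -/
def Compatible {L r c : ℕ} (k : Fin L → ℕ) (ρ : Fin r → ℕ) (γ : Fin c → ℕ) : Prop :=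
  ∃ (f : (i : Fin r) → Fin (ρ i) → Fin L) (g : (j : Fin c) → Fin (γ j) → Fin L),
    (∀ i, Function.Injective (f i)) ∧ (∀ j, Function.Injective (g j)) ∧
    ∀ l, (∑ i, (Finset.univ.filter fun n => f i n = l).card) +
      2 * (∑ j, (Finset.univ.filter fun n => g j n = l).card) ≤ k l - 1

/-! ### Critical points on a subset of a vector space -/

/-- `p` is a smooth point of `S` with tangent space `T`: some smooth diffeomorphism `Φ` from an
open neighbourhood of `p` onto an open set straightens `S` to a linear subspace `V`, and `T`
is the preimage of `V` under the differential of `Φ` at `p`. -/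
def IsSmoothPoint {E : Type*} [NormedAddCommGroup E] [NormedSpace ℝ E]
    (S : Set E) (p : E) (T : Submodule ℝ E) : Prop :=
  p ∈ S ∧ ∃ (Φ : OpenPartialHomeomorph E E) (V : Submodule ℝ E),
    p ∈ Φ.source ∧ ContDiffOn ℝ ∞ Φ Φ.source ∧ ContDiffOn ℝ ∞ Φ.symm Φ.target ∧
    (∀ x ∈ Φ.source, x ∈ S ↔ Φ x ∈ V) ∧
    T = V.comap (fderiv ℝ Φ p).toLinearMap

/-- The critical points of `f` on `S`: smooth points `p` of `S` such that the differential of `f`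
at `p` vanishes on the tangent space of `S` at `p`. -/
def critOn {E : Type*} [NormedAddCommGroup E] [NormedSpace ℝ E] (f : E → ℝ) (S : Set E) : Set E :=
  {p | ∃ T : Submodule ℝ E, IsSmoothPoint S p T ∧
    ∃ f' : E →L[ℝ] ℝ, HasFDerivAt f f' p ∧ ∀ v ∈ T, f' v = 0}

end LCN

end

/-! Filters are binary forms and composing layers multiplies them (`paramMap_eq`). Hence, at a
parameter with layer forms `P l` and product `P`, the image of the differential of the
parameterization is the sum over `l` of the multiples of `P / P l`, and criticality means that the
differential of the loss at `P` kills this image (`isCritical_paramLoss_iff`). Write `P` as a scalar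
times `∏ E s ^ m s` with coprime irreducible real factors. A compatible placement is the same as a
factorization of `P` along the layers in which every layer is squarefree: the bins of colour `s` are
the layers that contain `E s` (`compatible_iff`).

Compatible case: in a squarefree factorization every `P / P l` is a multiple of `∏ E s ^ (m s - 1)`.
Moving the scalar and the factors `E s` along curves in the multiple root locus shows that all
multiples of this form are tangent (`tangent_contains_multiples`), so criticality on the locus gives
criticality in parameter space (`exists_critical_of_compatible`).

Incompatible case: in every factorization some layer is divisible by a square `E s₀ ^ 2`
(`exists_sq_dvd_of_not_compatible`). At a critical parameter the differential then vanishes on all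
multiples of `∏ E s ^ (m s - e s)`, where `e s₀ = 2` and `e s = 1` otherwise
(`filterLossDeriv_eq_zero_of_sq_dvd`). These are too many conditions for generic data
(`forGenericData_not_isDegenerate`). The data enter the differential only through `X` and the `n +
1` numbers `dataVector`, `n` being the degree of `P`. In a degenerate configuration these numbers
are polynomials in `X`, the scalar, the `∑ deg E s` coefficients of the normalized factors, and `n -
∑ e s * deg E s` free entries of the differential, because vanishing on the multiples of a fixed
form is a linear recurrence (`mem_of_recurrence`). That is fewer than `n + 1` quantities besides
`X`, so `X` and `dataVector` satisfy a nontrivial polynomial relation, which generic data violate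
(`forGenericData_of_relation`). -/

namespace LCN

section Forms

open MvPolynomial

/-! ### Binary forms and their coefficients -/

/-- The binary form of degree `K - 1` attached to a filter with `K` entries. -/
noncomputable def formOf (K : ℕ) : (Fin K → ℝ) →ₗ[ℝ] MvPolynomial (Fin 2) ℝ :=
  Fintype.linearCombination ℝ (fun i : Fin K => X 0 ^ (K - 1 - (i : ℕ)) * X 1 ^ (i : ℕ))

/-- Dehomogenization of binary forms, `x ↦ 1` and `y ↦ X`. -/
noncomputable def dehom : MvPolynomial (Fin 2) ℝ →ₐ[ℝ] Polynomial ℝ :=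
  aeval ![1, Polynomial.X]

/-- The first `K` coefficients of the dehomogenization of a binary form. -/
noncomputable def coeffs (K : ℕ) : MvPolynomial (Fin 2) ℝ →ₗ[ℝ] (Fin K → ℝ) :=
  LinearMap.pi fun i => Polynomial.lcoeff ℝ i ∘ₗ dehom.toLinearMap

@[simp] lemma dehom_X_zero : dehom (X 0) = 1 := by simp [dehom]
@[simp] lemma dehom_X_one : dehom (X 1) = Polynomial.X := by simp [dehom]
@[simp] lemma dehom_C (a : ℝ) : dehom (C a) = Polynomial.C a := by
  simp [dehom, Polynomial.algebraMap_eq]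

lemma coeffs_apply (K : ℕ) (P : MvPolynomial (Fin 2) ℝ) (i : Fin K) :
    coeffs K P i = (dehom P).coeff i := rfl

lemma formOf_apply (K : ℕ) (w : Fin K → ℝ) :
    formOf K w = ∑ i : Fin K, C (w i) * X 0 ^ (K - 1 - (i : ℕ)) * X 1 ^ (i : ℕ) := by
  simp [formOf, Fintype.linearCombination_apply, smul_eq_C_mul, mul_assoc]

lemma filterPoly_eq {n : ℕ} (w : Fin (n + 1) → ℝ) : filterPoly w = formOf (n + 1) w := by
  rw [formOf_apply]; rfl

lemma isHomogeneous_formOf (K : ℕ) (w : Fin K → ℝ) : (formOf K w).IsHomogeneous (K - 1) := by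
  rw [formOf_apply]
  refine IsHomogeneous.sum _ _ _ fun i _ => ?_
  have := ((isHomogeneous_C (Fin 2) (w i)).mul (isHomogeneous_X_pow 0 (K - 1 - (i : ℕ)))).mul
    (isHomogeneous_X_pow (R := ℝ) (1 : Fin 2) (i : ℕ))
  convert this using 1
  have := i.2
  omega

lemma dehom_formOf (K : ℕ) (w : Fin K → ℝ) :
    dehom (formOf K w) = ∑ i : Fin K, Polynomial.C (w i) * Polynomial.X ^ (i : ℕ) := by
  simp [formOf_apply]

lemma coeffs_formOf (K : ℕ) (w : Fin K → ℝ) : coeffs K (formOf K w) = w := by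
  ext i
  rw [coeffs_apply, dehom_formOf]
  simp only [Polynomial.finsetSum_coeff, Polynomial.coeff_C_mul, Polynomial.coeff_X_pow,
    mul_ite, mul_one, mul_zero]
  rw [Finset.sum_eq_single i] <;> simp +contextual [Fin.ext_iff, eq_comm]

lemma coeff_dehom_formOf (K : ℕ) (w : Fin K → ℝ) (i : ℕ) :
    (dehom (formOf K w)).coeff i = if h : i < K then w ⟨i, h⟩ else 0 := by
  split_ifs with h
  · exact congrFun (coeffs_formOf K w) ⟨i, h⟩
  · rw [dehom_formOf, Polynomial.finsetSum_coeff]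
    refine Finset.sum_eq_zero fun j _ => ?_
    rw [Polynomial.coeff_C_mul_X_pow, if_neg (by omega)]

/-- The case `K = 0` is excluded because truncated subtraction makes `K - 1 = 0`, and a nonzero
constant cannot be recovered from an empty list of coefficients. -/
lemma formOf_coeffs {K : ℕ} (hK : 1 ≤ K) {P : MvPolynomial (Fin 2) ℝ}
    (hP : P.IsHomogeneous (K - 1)) : formOf K (coeffs K P) = P := by
  conv_rhs => rw [P.as_sum]
  conv_lhs => rw [P.as_sum]
  rw [map_sum, map_sum]
  refine Finset.sum_congr rfl fun m hm => ?_
  have hdeg : m 0 + m 1 = K - 1 := by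
    have := hP.degree_eq_sum_deg_support hm
    rw [this, ← Finsupp.degree_apply, Finsupp.degree_eq_sum, Fin.sum_univ_two]
  have hmon : (monomial m (coeff m P) : MvPolynomial (Fin 2) ℝ) =
      C (coeff m P) * X 0 ^ m 0 * X 1 ^ m 1 := by
    rw [monomial_eq, Finsupp.prod_fintype _ _ (by simp), Fin.prod_univ_two, mul_assoc]
  rw [hmon, formOf_apply, Finset.sum_eq_single ⟨m 1, by omega⟩]
  · rw [coeffs_apply]
    simp only [map_mul, dehom_C, map_pow, dehom_X_zero, dehom_X_one, one_pow, mul_one]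
    rw [Polynomial.coeff_C_mul_X_pow, if_pos rfl]
    congr 3
    omega
  · intro b _ hb
    rw [coeffs_apply]
    simp only [map_mul, dehom_C, map_pow, dehom_X_zero, dehom_X_one, one_pow, mul_one]
    rw [Polynomial.coeff_C_mul_X_pow, if_neg (fun h => hb (Fin.ext h))]
    simp
  · simp

/-- The cofactor of a homogeneous factor of a homogeneous polynomial can be taken homogeneous. -/
lemma exists_isHomogeneous_mul_eq {σ : Type*} {A B : MvPolynomial σ ℝ} {e m : ℕ}
    (hA : A.IsHomogeneous e) (hB : B.IsHomogeneous (e + m)) (h : A ∣ B) :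
    ∃ D : MvPolynomial σ ℝ, D.IsHomogeneous m ∧ B = A * D := by
  classical
  obtain ⟨D, rfl⟩ := h
  refine ⟨homogeneousComponent m D, homogeneousComponent_isHomogeneous _ _, ?_⟩
  rw [← homogeneousComponent_eq_self hB]
  -- Only the degree `m` component of the cofactor contributes to degree `e + m` of the product.
  conv_lhs => rw [← sum_homogeneousComponent D, Finset.mul_sum, map_sum]
  have : ∀ i ∈ Finset.range (D.totalDegree + 1),
      homogeneousComponent (e + m) (A * homogeneousComponent i D) =
        if i = m then A * homogeneousComponent m D else 0 := by
    intro i _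
    rw [homogeneousComponent_of_mem
      (hA.mul (homogeneousComponent_isHomogeneous i D) : _ ∈ homogeneousSubmodule _ _ _)]
    by_cases hi : i = m
    · simp [hi]
    · rw [if_neg (by omega), if_neg hi]
  rw [Finset.sum_congr rfl this]
  simp only [Finset.sum_ite_eq', Finset.mem_range]
  split_ifs with hm
  · rfl
  · rw [homogeneousComponent_eq_zero _ _ (by omega), mul_zero]

/-- Coprime binary forms of degrees `u` and `v` generate all binary forms of degree `u + v`. -/
lemma exists_add_of_isRelPrime {u v : ℕ} {U V Q : MvPolynomial (Fin 2) ℝ}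
    (hU : U.IsHomogeneous u) (hV : V.IsHomogeneous v) (hV0 : V ≠ 0)
    (hUV : IsRelPrime U V) (hQ : Q.IsHomogeneous (u + v)) :
    ∃ A B : MvPolynomial (Fin 2) ℝ, A.IsHomogeneous v ∧ B.IsHomogeneous u ∧ Q = U * A + V * B := by
  let Ψ : (Fin (v + 1) → ℝ) × (Fin (u + 1) → ℝ) →ₗ[ℝ] (Fin (u + v + 1) → ℝ) :=
    (coeffs (u + v + 1) ∘ₗ LinearMap.mulLeft ℝ U ∘ₗ formOf (v + 1)).coprod
      (coeffs (u + v + 1) ∘ₗ LinearMap.mulLeft ℝ V ∘ₗ formOf (u + 1))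
  have hΨ : ∀ z, formOf (u + v + 1) (Ψ z) = U * formOf (v + 1) z.1 + V * formOf (u + 1) z.2 := by
    intro z
    have h1 : Ψ z = coeffs (u + v + 1) (U * formOf (v + 1) z.1 + V * formOf (u + 1) z.2) := by
      simp [Ψ]
    rw [h1, formOf_coeffs (by omega)]
    refine IsHomogeneous.add (hU.mul (isHomogeneous_formOf (v + 1) z.1)) ?_
    have := hV.mul (isHomogeneous_formOf (u + 1) z.2)
    convert this using 1
    simp [add_comm]
  -- Coprimality leaves only the syzygy `(V, -U)`. The source has dimension `u + v + 2`, so the rank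
  -- is at least `u + v + 1`, the dimension of the target.
  have hker : Module.finrank ℝ (LinearMap.ker Ψ) ≤ 1 := by
    have hle : LinearMap.ker Ψ ≤ Submodule.span ℝ {(coeffs (v + 1) V, -coeffs (u + 1) U)} := by
      intro z hz
      have h0 : U * formOf (v + 1) z.1 + V * formOf (u + 1) z.2 = 0 := by
        rw [← hΨ, LinearMap.mem_ker.1 hz, map_zero]
      have hdvd : V ∣ formOf (v + 1) z.1 := by
        refine hUV.symm.dvd_of_dvd_mul_left (z := formOf (v + 1) z.1) ⟨-formOf (u + 1) z.2, ?_⟩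
        linear_combination h0
      obtain ⟨D, hD, hD'⟩ := exists_isHomogeneous_mul_eq (m := 0) hV
        (isHomogeneous_formOf (v + 1) z.1) hdvd
      obtain ⟨a, rfl⟩ : ∃ a, D = C a := ⟨coeff 0 D, by
        rw [← totalDegree_eq_zero_iff_eq_C]; exact (totalDegree_zero_iff_isHomogeneous _).2 hD⟩
      have h2 : formOf (u + 1) z.2 = -(C a * U) := by
        have : V * (formOf (u + 1) z.2 + C a * U) = 0 := by
          rw [hD'] at h0; linear_combination h0
        have := (mul_eq_zero.1 this).resolve_left hV0
        linear_combination this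
      rw [Submodule.mem_span_singleton]
      refine ⟨a, Prod.ext ?_ ?_⟩
      · change a • coeffs (v + 1) V = z.1
        rw [← coeffs_formOf _ z.1, hD', mul_comm, ← smul_eq_C_mul, map_smul]
      · change a • -coeffs (u + 1) U = z.2
        rw [← coeffs_formOf _ z.2, h2, ← smul_eq_C_mul, map_neg, map_smul, smul_neg]
    exact (Submodule.finrank_mono hle).trans (by
      simpa using finrank_span_le_card (R := ℝ) {(coeffs (v + 1) V, -coeffs (u + 1) U)})
  have hrange : LinearMap.range Ψ = ⊤ := by
    apply Submodule.eq_top_of_finrank_eq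
    have h1 := Ψ.finrank_range_add_finrank_ker
    have h2 := (LinearMap.range Ψ).finrank_le
    simp only [Module.finrank_prod, Module.finrank_fin_fun] at h1 h2 ⊢
    omega
  obtain ⟨z, hz⟩ := LinearMap.range_eq_top.1 hrange (coeffs (u + v + 1) Q)
  refine ⟨_, _, isHomogeneous_formOf (v + 1) z.1, isHomogeneous_formOf (u + 1) z.2, ?_⟩
  rw [← hΨ, hz, formOf_coeffs (by omega) hQ]

/-- Pairwise coprime binary forms `E s` of degrees `e s`: every form of degree `∑ e s` is a
combination of `∏ E s` and of products in which one `E s` is replaced. -/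
lemma exists_sum_of_pairwise_isRelPrime {σ : Type*} [DecidableEq σ] (S : Finset σ)
    (E : σ → MvPolynomial (Fin 2) ℝ) (e : σ → ℕ) (hE : ∀ s ∈ S, (E s).IsHomogeneous (e s))
    (h0 : ∀ s ∈ S, E s ≠ 0) (hrp : ∀ s ∈ S, ∀ t ∈ S, s ≠ t → IsRelPrime (E s) (E t))
    {Q : MvPolynomial (Fin 2) ℝ} (hQ : Q.IsHomogeneous (∑ s ∈ S, e s)) :
    ∃ (b : ℝ) (A : σ → MvPolynomial (Fin 2) ℝ), (∀ s ∈ S, (A s).IsHomogeneous (e s)) ∧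
      Q = C b * ∏ s ∈ S, E s + ∑ s ∈ S, A s * ∏ t ∈ S.erase s, E t := by
  induction S using Finset.induction_on generalizing Q with
  | empty =>
    -- A form of degree `0` is a constant; this is the origin of the extra term with `b`.
    refine ⟨coeff 0 Q, 0, by simp, ?_⟩
    simp only [Finset.sum_empty, Finset.prod_empty, mul_one, add_zero] at hQ ⊢
    rw [← totalDegree_eq_zero_iff_eq_C]; exact (totalDegree_zero_iff_isHomogeneous _).2 hQ
  | insert s S hs ih =>
    rw [Finset.sum_insert hs] at hQ
    have hS : ∀ t ∈ S, t ≠ s := fun t ht h => hs (h ▸ ht)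
    obtain ⟨A, B, hA, hB, rfl⟩ := exists_add_of_isRelPrime (hE s (Finset.mem_insert_self _ _))
      (IsHomogeneous.prod S E e fun t ht => hE t (Finset.mem_insert_of_mem ht))
      (Finset.prod_ne_zero_iff.2 fun t ht => h0 t (Finset.mem_insert_of_mem ht))
      (IsRelPrime.prod_right fun t ht => hrp s (Finset.mem_insert_self _ _) t
        (Finset.mem_insert_of_mem ht) (hS t ht).symm) hQ
    obtain ⟨b, A', hA', rfl⟩ := ih (fun t ht => hE t (Finset.mem_insert_of_mem ht))
      (fun t ht => h0 t (Finset.mem_insert_of_mem ht))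
      (fun t ht t' ht' => hrp t (Finset.mem_insert_of_mem ht) t' (Finset.mem_insert_of_mem ht')) hA
    refine ⟨b, Function.update A' s B, fun t ht => ?_, ?_⟩
    · by_cases hts : t = s
      · subst hts; simpa using hB
      · rw [Function.update_of_ne hts]
        exact hA' t ((Finset.mem_insert.1 ht).resolve_left hts)
    · rw [Finset.sum_insert hs, Finset.prod_insert hs, Finset.erase_insert hs,
        Function.update_self]
      have : ∑ t ∈ S, Function.update A' s B t * ∏ t' ∈ (insert s S).erase t, E t' =
          E s * ∑ t ∈ S, A' t * ∏ t' ∈ S.erase t, E t' := by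
        rw [Finset.mul_sum]
        refine Finset.sum_congr rfl fun t ht => ?_
        rw [Function.update_of_ne (hS t ht), Finset.erase_insert_of_ne (hS t ht).symm,
          Finset.prod_insert (fun h => hs (Finset.mem_of_mem_erase h))]
        ring
      rw [this]
      ring

/-! ### The end-to-end filter of a network -/

section Network

variable {L : ℕ}

/-- The map that sends the filters of the layers to the filter of their composition. -/
noncomputable def endFilter (k : Fin L → ℕ) :
    MultilinearMap ℝ (fun l => Fin (k l) → ℝ) (Fin (endDegree k + 1) → ℝ) :=
  (coeffs (endDegree k + 1)).compMultilinearMap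
    ((MultilinearMap.mkPiAlgebra ℝ (Fin L) (MvPolynomial (Fin 2) ℝ)).compLinearMap
      fun l => formOf (k l))

lemma endFilter_apply (k : Fin L → ℕ) (θ : Params k) :
    endFilter k θ = coeffs (endDegree k + 1) (∏ l, formOf (k l) (θ l)) := rfl

lemma formOf_endFilter (k : Fin L → ℕ) (θ : Params k) :
    formOf (endDegree k + 1) (endFilter k θ) = ∏ l, formOf (k l) (θ l) :=
  formOf_coeffs (by omega) (IsHomogeneous.prod _ _ _ fun l _ => isHomogeneous_formOf (k l) (θ l))

/-- Row `i` lists the coefficients of `X ^ i` times the polynomial of the filter, so multiplying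
convolutional matrices becomes multiplying polynomials. -/
lemma convMatrix_apply {m n K : ℕ} (w : Fin K → ℝ) (i : Fin m) (j : Fin n) :
    (convMatrix w : Matrix (Fin m) (Fin n) ℝ) i j =
      (Polynomial.X ^ (i : ℕ) * dehom (formOf K w)).coeff j := by
  rw [Polynomial.coeff_X_pow_mul', coeff_dehom_formOf, convMatrix]
  split_ifs with h1 h2
  · rw [Finset.sum_eq_single ⟨(j : ℕ) - i, h2⟩]
    · rw [if_pos (by simp only; omega)]
    · intro b _ hb
      rw [if_neg]
      intro h
      apply hb
      ext
      simp only
      omega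
    · simp
  · exact Finset.sum_eq_zero fun t _ => if_neg (by omega)
  · exact Finset.sum_eq_zero fun t _ => if_neg (by omega)

lemma convMatrix_mul_apply {a a' b K : ℕ} (hK : 1 ≤ K) (h : a' + K = a + 1) (w : Fin K → ℝ)
    (M : Matrix (Fin a) (Fin b) ℝ) (q : Polynomial ℝ)
    (hM : ∀ i j, M i j = (Polynomial.X ^ (i : ℕ) * q).coeff j) (i : Fin a') (j : Fin b) :
    ((convMatrix w : Matrix (Fin a') (Fin a) ℝ) * M) i j =
      (Polynomial.X ^ (i : ℕ) * (dehom (formOf K w) * q)).coeff j := by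
  have hi := i.2
  -- Row `i` of the left factor has degree at most `(a' - 1) + (K - 1) = a - 1`, so its `a` columns
  -- truncate nothing.
  have hdeg : (Polynomial.X ^ (i : ℕ) * dehom (formOf K w)).natDegree < a := by
    rw [← Nat.le_sub_one_iff_lt (by omega), Polynomial.natDegree_le_iff_coeff_eq_zero]
    intro m hm
    rw [Polynomial.coeff_X_pow_mul', coeff_dehom_formOf]
    split_ifs with h1 h2
    · omega
    · rfl
    · rfl
  rw [Matrix.mul_apply, ← mul_assoc]
  conv_rhs => rw [Polynomial.as_sum_range' _ a hdeg, Finset.sum_mul, Polynomial.finsetSum_coeff,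
    Finset.sum_range]
  refine Finset.sum_congr rfl fun m _ => ?_
  rw [convMatrix_apply, hM, ← Polynomial.C_mul_X_pow_eq_monomial, mul_assoc,
    Polynomial.coeff_C_mul]

lemma partialProduct_apply (d : Fin (L + 1) → ℕ) (k : Fin L → ℕ) (hk : ∀ l, 1 ≤ k l)
    (hd : ∀ l : Fin L, d l.succ + k l = d l.castSucc + 1) (θ : Params k) (m : Fin (L + 1)) :
    ∀ i j, partialProduct d k θ m i j = (Polynomial.X ^ (i : ℕ) *
      ∏ l ∈ Finset.univ.filter (fun l : Fin L => l.castSucc < m),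
        dehom (formOf (k l) (θ l))).coeff j := by
  induction m using Fin.induction with
  | zero =>
    intro i j
    simp [partialProduct, Matrix.one_apply, Polynomial.coeff_X_pow, Fin.ext_iff, eq_comm]
  | succ l ih =>
    intro i j
    have hf : Finset.univ.filter (fun l' : Fin L => l'.castSucc < l.succ) =
        insert l (Finset.univ.filter (fun l' : Fin L => l'.castSucc < l.castSucc)) := by
      ext l'
      simp only [Finset.mem_filter, Finset.mem_univ, true_and, Finset.mem_insert, Fin.lt_def,
        Fin.val_castSucc, Fin.val_succ, Fin.ext_iff]
      omega
    rw [hf, Finset.prod_insert (by simp)]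
    exact convMatrix_mul_apply (hk l) (hd l) (θ l) (partialProduct d k θ l.castSucc) _ ih i j

lemma paramMap_eq (d : Fin (L + 1) → ℕ) (k : Fin L → ℕ) (hk : ∀ l, 1 ≤ k l)
    (hd : ∀ l : Fin L, d l.succ + k l = d l.castSucc + 1) (θ : Params k) :
    paramMap d k θ = convMatrix (endFilter k θ) := by
  ext i j
  rw [paramMap, partialProduct_apply d k hk hd, convMatrix_apply, formOf_endFilter, map_prod]
  congr 3
  ext l
  simp [Fin.castSucc_lt_last]

lemma dim_eq (d : Fin (L + 1) → ℕ) (k : Fin L → ℕ) (hk : ∀ l, 1 ≤ k l)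
    (hd : ∀ l : Fin L, d l.succ + k l = d l.castSucc + 1) :
    d (Fin.last L) + endDegree k = d 0 := by
  have h3 : d 0 + ∑ l : Fin L, d l.succ = (∑ l : Fin L, d l.castSucc) + d (Fin.last L) := by
    rw [← Fin.sum_univ_succ, ← Fin.sum_univ_castSucc]
  have h4 : ∑ l : Fin L, d l.castSucc = ∑ l : Fin L, d l.succ + endDegree k := by
    rw [endDegree, ← Finset.sum_add_distrib]
    refine Finset.sum_congr rfl fun l _ => ?_
    have := hd l
    have := hk l
    omega
  omega

/-- Expanding every filter in the standard basis shows that the map is polynomial in the entries;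
continuity gives access to the derivative of continuous multilinear maps. -/
lemma continuous_endFilter (k : Fin L → ℕ) : Continuous (endFilter k) := by
  have h : ∀ θ : Params k, endFilter k θ =
      ∑ r : (l : Fin L) → Fin (k l), (∏ l, θ l (r l)) • endFilter k fun l => Pi.single (r l) 1 := by
    intro θ
    have h1 : θ = fun l => ∑ i, θ l i • (Pi.single i 1 : Fin (k l) → ℝ) := by
      funext l
      exact pi_eq_sum_univ' (θ l)
    conv_lhs => rw [h1, MultilinearMap.map_sum]
    exact Finset.sum_congr rfl fun r _ => MultilinearMap.map_smul_univ _ _ _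
  rw [show ⇑(endFilter k) = _ from funext h]
  fun_prop

/-- The derivative of the end-to-end filter. -/
noncomputable def endFilterDeriv (k : Fin L → ℕ) (θ : Params k) :
    Params k →L[ℝ] (Fin (endDegree k + 1) → ℝ) :=
  ContinuousMultilinearMap.linearDeriv ⟨endFilter k, continuous_endFilter k⟩ θ

lemma hasFDerivAt_endFilter (k : Fin L → ℕ) (θ : Params k) :
    HasFDerivAt (endFilter k) (endFilterDeriv k θ) θ :=
  ContinuousMultilinearMap.hasFDerivAt ⟨endFilter k, continuous_endFilter k⟩ θ

lemma endFilterDeriv_apply (k : Fin L → ℕ) (θ η : Params k) :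
    endFilterDeriv k θ η = ∑ l, coeffs (endDegree k + 1)
      (formOf (k l) (η l) * ∏ l' ∈ Finset.univ.erase l, formOf (k l') (θ l')) := by
  rw [endFilterDeriv, ContinuousMultilinearMap.linearDeriv_apply]
  refine Finset.sum_congr rfl fun l _ => ?_
  change endFilter k _ = _
  rw [endFilter_apply, ← Finset.mul_prod_erase _ _ (Finset.mem_univ l), Function.update_self]
  congr 2
  refine Finset.prod_congr rfl fun l' hl' => ?_
  rw [Function.update_of_ne (Finset.ne_of_mem_erase hl')]

end Network

/-! ### The derivative of the loss -/

section Loss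

variable {m n N K : ℕ}

/-- The entries of `V X`, where `V` is the convolutional matrix of a filter, as linear functions
of the filter. -/
noncomputable def outputEntry (X : Matrix (Fin n) (Fin N) ℝ) (i : Fin m) (j : Fin N) :
    (Fin K → ℝ) →L[ℝ] ℝ :=
  LinearMap.toContinuousLinearMap
    { toFun := fun w => ((convMatrix w : Matrix (Fin m) (Fin n) ℝ) * X) i j
      map_add' := fun w w' => by
        simp only [Matrix.mul_apply, convMatrix_apply, map_add, mul_add, Polynomial.coeff_add,
          add_mul, Finset.sum_add_distrib]
      map_smul' := fun a w => by
        simp only [Matrix.mul_apply, convMatrix_apply, map_smul, mul_smul_comm,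
          Polynomial.coeff_smul, smul_mul_assoc, Finset.smul_sum, RingHom.id_apply] }

lemma outputEntry_apply (X : Matrix (Fin n) (Fin N) ℝ) (i : Fin m) (j : Fin N) (w : Fin K → ℝ) :
    outputEntry X i j w = ((convMatrix w : Matrix (Fin m) (Fin n) ℝ) * X) i j := rfl

/-- The derivative of the square loss in function space. -/
noncomputable def filterLossDeriv (X : Matrix (Fin n) (Fin N) ℝ) (Y : Matrix (Fin m) (Fin N) ℝ)
    (w : Fin K → ℝ) : (Fin K → ℝ) →L[ℝ] ℝ :=
  ∑ i : Fin m, ∑ j : Fin N, (2 * (outputEntry X i j w - Y i j)) • outputEntry X i j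

lemma hasFDerivAt_filterLoss (X : Matrix (Fin n) (Fin N) ℝ) (Y : Matrix (Fin m) (Fin N) ℝ)
    (w : Fin K → ℝ) : HasFDerivAt (filterLoss X Y) (filterLossDeriv X Y w) w := by
  have h : (filterLoss X Y : (Fin K → ℝ) → ℝ) =
      fun w => ∑ i : Fin m, ∑ j : Fin N, (outputEntry X i j w - Y i j) ^ 2 := rfl
  rw [h, filterLossDeriv]
  refine HasFDerivAt.fun_sum fun i _ => HasFDerivAt.fun_sum fun j _ => ?_
  have := ((outputEntry (K := K) X i j).hasFDerivAt (x := w)).sub_const (Y i j) |>.pow 2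
  simpa using this

end Loss

section Critical

variable {L N : ℕ}

lemma isCritical_paramLoss_iff (d : Fin (L + 1) → ℕ) (k : Fin L → ℕ) (hk : ∀ l, 1 ≤ k l)
    (hd : ∀ l : Fin L, d l.succ + k l = d l.castSucc + 1)
    (X : Matrix (Fin (d 0)) (Fin N) ℝ) (Y : Matrix (Fin (d (Fin.last L))) (Fin N) ℝ)
    (θ : Params k) :
    IsCritical (paramLoss d k X Y) θ ↔
      ∀ η, filterLossDeriv X Y (endFilter k θ) (endFilterDeriv k θ η) = 0 := by
  have h : paramLoss d k X Y = filterLoss X Y ∘ endFilter k := by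
    funext θ
    rw [paramLoss, paramMap_eq d k hk hd]
    rfl
  have h2 : HasFDerivAt (paramLoss d k X Y)
      ((filterLossDeriv X Y (endFilter k θ)).comp (endFilterDeriv k θ)) θ := by
    rw [h]
    exact (hasFDerivAt_filterLoss X Y _).comp θ (hasFDerivAt_endFilter k θ)
  constructor
  · intro hc η
    have := hc.unique h2
    exact (DFunLike.congr_fun this η).symm
  · intro hc
    have : (filterLossDeriv X Y (endFilter k θ)).comp (endFilterDeriv k θ) = 0 :=
      ContinuousLinearMap.ext hc
    rwa [this] at h2

end Critical

/-! ### Forms with a given real root multiplicity pattern -/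

section Pattern

variable {r c : ℕ}

/-- The degrees of the factors of a form with `r` real linear and `c` quadratic factors. -/
def factorDegree (r c : ℕ) : Fin r ⊕ Fin c → ℕ := Sum.elim (fun _ => 1) (fun _ => 2)

lemma sum_patternPartition (ρ : Fin r → ℕ) (γ : Fin c → ℕ) :
    ∑ i, patternPartition ρ γ i = ∑ s, factorDegree r c s * Sum.elim ρ γ s := by
  simp only [patternPartition, factorDegree, Fintype.sum_sum_type, Sum.elim_inl, Sum.elim_inr,
    one_mul, two_mul, Finset.sum_add_distrib]

/-- Pairwise coprime irreducible real forms, the first `r` linear and the last `c` quadratic. -/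
structure IsFactorFamily (E : Fin r ⊕ Fin c → MvPolynomial (Fin 2) ℝ) : Prop where
  isHomogeneous : ∀ s, (E s).IsHomogeneous (factorDegree r c s)
  irreducible : ∀ s, Irreducible (E s)
  isRelPrime : ∀ s t, s ≠ t → IsRelPrime (E s) (E t)

lemma isUnit_iff_exists_C {σ : Type*} {P : MvPolynomial σ ℝ} :
    IsUnit P ↔ ∃ a : ℝ, a ≠ 0 ∧ P = C a := by
  rw [MvPolynomial.isUnit_iff_eq_C_of_isReduced]
  constructor
  · rintro ⟨a, ha, rfl⟩
    exact ⟨a, ha.ne_zero, rfl⟩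
  · rintro ⟨a, ha, rfl⟩
    exact ⟨a, isUnit_iff_ne_zero.2 ha, rfl⟩

/-- If one irreducible factor divides another, they differ by a unit, that is, by a nonzero
constant, which contradicts linear independence. -/
lemma HasRrmp.exists_isFactorFamily {ρ : Fin r → ℕ} {γ : Fin c → ℕ} {P : MvPolynomial (Fin 2) ℝ}
    (h : HasRrmp ρ γ P) : ∃ (a : ℝ) (E : Fin r ⊕ Fin c → MvPolynomial (Fin 2) ℝ), a ≠ 0 ∧
      IsFactorFamily E ∧ P = C a * ∏ s, E s ^ Sum.elim ρ γ s := by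
  obtain ⟨a, p, q, ha, hp, hq, hpq, rfl⟩ := h
  refine ⟨a, Sum.elim p q, ha, ⟨?_, ?_, ?_⟩, ?_⟩
  · rintro (i | j)
    · exact (hp i).1
    · exact (hq j).1
  · rintro (i | j)
    · exact (hp i).2
    · exact (hq j).2
  · have hirr : ∀ s, Irreducible (Sum.elim p q s) := by
      rintro (i | j)
      · exact (hp i).2
      · exact (hq j).2
    intro s t hst
    rw [(hirr s).isRelPrime_iff_not_dvd]
    intro hdvd
    obtain ⟨u, hu⟩ := (hirr s).associated_of_dvd (hirr t) hdvd
    obtain ⟨b, -, hb⟩ := isUnit_iff_exists_C.1 u.isUnit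
    have := LinearIndependent.pair_iff.1 (hpq hst) b (-1) (by
      rw [← hu, hb, smul_eq_C_mul]
      simp [mul_comm])
    simp at this
  · simp [Fintype.prod_sum_type, mul_assoc]

lemma exists_linear_coeff {R : Type*} [CommRing R] {P : MvPolynomial (Fin 2) R}
    (hP : P.IsHomogeneous 1) : ∃ α β : R, P = C α * X 0 + C β * X 1 := by
  have h : P ∈ homogeneousSubmodule (Fin 2) R 1 := hP
  rw [homogeneousSubmodule_one_eq_span_X] at h
  induction h using Submodule.span_induction with
  | mem x hx =>
    obtain ⟨i, rfl⟩ := hx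
    fin_cases i
    · exact ⟨1, 0, by simp⟩
    · exact ⟨0, 1, by simp⟩
  | zero => exact ⟨0, 0, by simp⟩
  | add x y hx hy h1 h2 =>
    have hh : ∀ x ∈ Submodule.span R (Set.range X), (x : MvPolynomial (Fin 2) R).IsHomogeneous 1 :=
      fun x hx => by
        rw [← homogeneousSubmodule_one_eq_span_X] at hx
        exact hx
    obtain ⟨a, b, rfl⟩ := h1 (hh x hx)
    obtain ⟨a', b', rfl⟩ := h2 (hh y hy)
    exact ⟨a + a', b + b', by simp only [map_add]; ring⟩
  | smul t x hx h1 =>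
    obtain ⟨a, b, rfl⟩ := h1 (by
      rw [← homogeneousSubmodule_one_eq_span_X] at hx
      exact hx)
    exact ⟨t * a, t * b, by simp only [map_mul, smul_eq_C_mul]; ring⟩

lemma exists_quadratic_coeff {P : MvPolynomial (Fin 2) ℝ} (hP : P.IsHomogeneous 2) :
    ∃ α β δ : ℝ, P = C α * X 0 ^ 2 + C β * (X 0 * X 1) + C δ * X 1 ^ 2 := by
  refine ⟨coeffs 3 P 0, coeffs 3 P 1, coeffs 3 P 2, ?_⟩
  conv_lhs => rw [← formOf_coeffs (K := 3) (by omega) hP, formOf_apply, Fin.sum_univ_three]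
  simp [mul_assoc]

/-- Real binary quadratic forms split over the complex numbers. -/
lemma exists_complex_factorization {P : MvPolynomial (Fin 2) ℝ} (hP : P.IsHomogeneous 2) :
    ∃ A B : MvPolynomial (Fin 2) ℂ, A.IsHomogeneous 1 ∧ B.IsHomogeneous 1 ∧
      MvPolynomial.map (algebraMap ℝ ℂ) P = A * B := by
  have hlin : ∀ x y : ℂ, (C x * X 0 + C y * X 1 : MvPolynomial (Fin 2) ℂ).IsHomogeneous 1 :=
    fun x y => (isHomogeneous_C_mul_X x 0).add (isHomogeneous_C_mul_X y 1)
  obtain ⟨α, β, δ, rfl⟩ := exists_quadratic_coeff hP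
  simp only [map_add, map_mul, map_C, map_pow, map_X]
  by_cases hα : α = 0
  · refine ⟨C 0 * X 0 + C 1 * X 1, C (β : ℂ) * X 0 + C (δ : ℂ) * X 1, hlin _ _, hlin _ _, ?_⟩
    simp only [hα, map_zero, map_one, Complex.coe_algebraMap]
    ring
  · have hα' : (α : ℂ) ≠ 0 := by exact_mod_cast hα
    obtain ⟨s, hs⟩ := IsAlgClosed.exists_pow_nat_eq ((β : ℂ) ^ 2 - 4 * α * δ) (n := 2) (by norm_num)
    refine ⟨C (α : ℂ) * X 0 + C ((β - s) / 2) * X 1, C 1 * X 0 + C ((β + s) / (2 * α)) * X 1,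
      hlin _ _, hlin _ _, ?_⟩
    have h1 : (β : ℂ) = α * ((β + s) / (2 * α)) + (β - s) / 2 := by field_simp; ring
    have h2 : (δ : ℂ) = (β - s) / 2 * ((β + s) / (2 * α)) := by
      field_simp
      linear_combination hs
    simp only [Complex.coe_algebraMap]
    rw [show (C (β : ℂ) : MvPolynomial (Fin 2) ℂ) =
        C (α : ℂ) * C ((β + s) / (2 * α)) + C ((β - s) / 2) by rw [← C_mul, ← C_add, ← h1],
      show (C (δ : ℂ) : MvPolynomial (Fin 2) ℂ) = C ((β - s) / 2) * C ((β + s) / (2 * α)) by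
        rw [← C_mul, ← h2], map_one]
    ring

lemma isHomogeneous_C_mul_prod {E : Fin r ⊕ Fin c → MvPolynomial (Fin 2) ℝ}
    (hE : ∀ s, (E s).IsHomogeneous (factorDegree r c s)) (a : ℝ) (m : Fin r ⊕ Fin c → ℕ) :
    (C a * ∏ s, E s ^ m s).IsHomogeneous (∑ s, factorDegree r c s * m s) :=
  (IsHomogeneous.prod _ _ _ fun s _ => (hE s).pow (m s)).C_mul a

/-- Products of real linear and quadratic forms with the given exponents lie on the multiple root
locus. -/
lemma mem_multipleRootLocus (ρ : Fin r → ℕ) (γ : Fin c → ℕ) (a : ℝ)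
    {E : Fin r ⊕ Fin c → MvPolynomial (Fin 2) ℝ}
    (hE : ∀ s, (E s).IsHomogeneous (factorDegree r c s)) :
    C a * ∏ s, E s ^ Sum.elim ρ γ s ∈ multipleRootLocus (patternPartition ρ γ) := by
  refine ⟨?_, ?_⟩
  · rw [sum_patternPartition]
    exact isHomogeneous_C_mul_prod hE a _
  · choose A B hA hB hAB using fun j => exists_complex_factorization (hE (Sum.inr j))
    refine ⟨a, Sum.elim (fun i => MvPolynomial.map (algebraMap ℝ ℂ) (E (Sum.inl i)))
      (Sum.elim A B), ?_, ?_⟩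
    · rintro (i | j | j)
      · exact (hE (Sum.inl i)).map _
      · exact hA j
      · exact hB j
    · simp only [patternPartition, Fintype.prod_sum_type, map_mul, map_prod, map_pow, map_C, hAB,
        Sum.elim_inl, Sum.elim_inr, mul_pow, Finset.prod_mul_distrib, Complex.coe_algebraMap]

end Pattern

/-! ### Tangent vectors -/

/-- In the straightening chart the curve stays in the linear subspace `V` near `0`, so its
difference quotients lie in `V`, and `V` is closed. -/
lemma IsSmoothPoint.mem_of_hasDerivAt {E : Type*} [NormedAddCommGroup E] [NormedSpace ℝ E]
    [FiniteDimensional ℝ E] {S : Set E} {p : E} {T : Submodule ℝ E} (h : IsSmoothPoint S p T)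
    {u : ℝ → E} {v : E} (hu : HasDerivAt u v 0) (h0 : u 0 = p) (hS : ∀ t, u t ∈ S) : v ∈ T := by
  obtain ⟨hp, Φ, V, hpΦ, hΦ, -, hSV, rfl⟩ := h
  have hd : HasFDerivAt Φ (fderiv ℝ Φ p) (u 0) := by
    rw [h0]
    exact ((hΦ.contDiffAt (Φ.open_source.mem_nhds hpΦ)).differentiableAt (by simp)).hasFDerivAt
  have hc : HasDerivAt (Φ ∘ u) (fderiv ℝ Φ p v) 0 := hd.comp_hasDerivAt 0 hu
  have hsrc : ∀ᶠ t in nhds (0 : ℝ), Φ (u t) ∈ V := by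
    have : u ⁻¹' Φ.source ∈ nhds (0 : ℝ) :=
      hu.continuousAt.preimage_mem_nhds (by rw [h0]; exact Φ.open_source.mem_nhds hpΦ)
    filter_upwards [this] with t ht
    exact (hSV _ ht).1 (hS t)
  have h1 : Φ (u 0) ∈ V := hsrc.self_of_nhds
  refine V.closed_of_finiteDimensional.mem_of_tendsto (hasDerivAt_iff_tendsto_slope.1 hc) ?_
  filter_upwards [hsrc.filter_mono nhdsWithin_le_nhds] with t ht
  exact V.smul_mem _ (V.sub_mem ht h1)

/-- Differentiation takes place after a linear map `Λ` into a normed space. Splitting off one factor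
`A + C t * B` and absorbing `A` or `B` into `D` drives the induction, hence the quantifier over `D`.
-/
lemma hasDerivAt_linear_pow_mul {W : Type*} [NormedAddCommGroup W] [NormedSpace ℝ W]
    (Λ : MvPolynomial (Fin 2) ℝ →ₗ[ℝ] W) (A B : MvPolynomial (Fin 2) ℝ) (m : ℕ) :
    ∀ D : MvPolynomial (Fin 2) ℝ, HasDerivAt (fun t : ℝ => Λ ((A + C t * B) ^ m * D))
      (Λ ((m : MvPolynomial (Fin 2) ℝ) * A ^ (m - 1) * B * D)) 0 := by
  induction m with
  | zero => intro D; simpa using hasDerivAt_const (0 : ℝ) (Λ D)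
  | succ m ih =>
    intro D
    have h1 := (ih (A * D)).add ((hasDerivAt_id (0 : ℝ)).smul (ih (B * D)))
    have h2 : (fun t : ℝ => Λ ((A + C t * B) ^ (m + 1) * D)) =
        (fun t : ℝ => Λ ((A + C t * B) ^ m * (A * D))) +
          (id : ℝ → ℝ) • (fun t : ℝ => Λ ((A + C t * B) ^ m * (B * D))) := by
      funext t
      simp only [Pi.add_apply, Pi.smul_apply', id]
      rw [← map_smul, ← map_add, smul_eq_C_mul]
      congr 1
      ring
    rw [h2]
    convert h1 using 1
    simp only [id, zero_smul, zero_add, map_zero, zero_mul, add_zero, one_smul]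
    rw [← map_add]
    congr 1
    rcases m with _ | m
    · simp
    · push_cast
      ring

/-- The tangent space of the multiple root locus at a form with exactly the given pattern contains
all multiples of `∏ E s ^ (m s - 1)`. -/
lemma tangent_contains_multiples {r c n : ℕ} {ρ : Fin r → ℕ} {γ : Fin c → ℕ} (hρ : ∀ i, 1 ≤ ρ i)
    (hγ : ∀ j, 1 ≤ γ j) (hn : ∑ i, patternPartition ρ γ i = n)
    {w : Fin (n + 1) → ℝ} {T : Submodule ℝ (Fin (n + 1) → ℝ)}
    (hT : IsSmoothPoint (filterPoly ⁻¹' multipleRootLocus (patternPartition ρ γ)) w T)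
    {a : ℝ} {E : Fin r ⊕ Fin c → MvPolynomial (Fin 2) ℝ} (ha : a ≠ 0) (hE : IsFactorFamily E)
    (hw : filterPoly w = C a * ∏ s, E s ^ Sum.elim ρ γ s)
    {Q : MvPolynomial (Fin 2) ℝ} (hQ : Q.IsHomogeneous (∑ s, factorDegree r c s)) :
    coeffs (n + 1) ((∏ s, E s ^ (Sum.elim ρ γ s - 1)) * Q) ∈ T := by
  classical
  set m : Fin r ⊕ Fin c → ℕ := Sum.elim ρ γ with hm
  have hm1 : ∀ s, 1 ≤ m s := by
    rintro (i | j)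
    · exact hρ i
    · exact hγ j
  rw [sum_patternPartition] at hn
  have hwc : w = coeffs (n + 1) (C a * ∏ s, E s ^ m s) := by
    rw [← hw, filterPoly_eq, coeffs_formOf]
  have hmem : ∀ (b : ℝ) (E' : Fin r ⊕ Fin c → MvPolynomial (Fin 2) ℝ),
      (∀ s, (E' s).IsHomogeneous (factorDegree r c s)) →
      coeffs (n + 1) (C b * ∏ s, E' s ^ m s) ∈
        filterPoly ⁻¹' multipleRootLocus (patternPartition ρ γ) := by
    intro b E' hE'
    rw [Set.mem_preimage, filterPoly_eq, formOf_coeffs (by omega)]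
    · exact mem_multipleRootLocus ρ γ b hE'
    · have := isHomogeneous_C_mul_prod hE' b m
      rwa [hn] at this
  -- This splits a multiple of `∏ E s ^ (m s - 1)` into a rescaling of the whole form and
  -- first-order variations of the single factors.
  obtain ⟨b, A, hA, rfl⟩ := exists_sum_of_pairwise_isRelPrime Finset.univ E (factorDegree r c)
    (fun s _ => hE.isHomogeneous s) (fun s _ => (hE.irreducible s).ne_zero)
    (fun s _ t _ => hE.isRelPrime s t) hQ
  have hprod : (∏ s, E s ^ (m s - 1)) * ∏ s, E s = ∏ s, E s ^ m s := by
    rw [← Finset.prod_mul_distrib]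
    refine Finset.prod_congr rfl fun s _ => ?_
    rw [← pow_succ, Nat.sub_add_cancel (hm1 s)]
  rw [mul_add, map_add, Finset.mul_sum, map_sum]
  refine T.add_mem ?_ (T.sum_mem fun s _ => ?_)
  -- The locus is a cone, so the curve `(1 + t) • w` makes `w` itself tangent.
  · have hscale : w ∈ T := by
      refine hT.mem_of_hasDerivAt (u := fun t => (1 + t) • w) (v := w) ?_ (by simp) ?_
      · simpa using ((hasDerivAt_id (0 : ℝ)).const_add 1).smul_const w
      · intro t
        have := hmem ((1 + t) * a) E hE.isHomogeneous
        rwa [C_mul, mul_assoc, ← smul_eq_C_mul, map_smul, ← hwc] at this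
    have : (∏ s, E s ^ (m s - 1)) * (C b * ∏ s, E s) = (b / a) • (C a * ∏ s, E s ^ m s) := by
      rw [← hprod, smul_eq_C_mul, ← mul_assoc (C (b / a)), ← C_mul, div_mul_cancel₀ _ ha]
      ring
    rw [this, map_smul, ← hwc]
    exact T.smul_mem _ hscale
  -- Velocity of the curve that replaces `E s` by `E s + t A s`; it is `m s * a` times the required
  -- vector.
  · have key : coeffs (n + 1) ((m s : MvPolynomial (Fin 2) ℝ) * E s ^ (m s - 1) * A s *
        (C a * ∏ t ∈ Finset.univ.erase s, E t ^ m t)) ∈ T := by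
      refine hT.mem_of_hasDerivAt (hasDerivAt_linear_pow_mul (coeffs (n + 1)) (E s) (A s) (m s)
        (C a * ∏ t ∈ Finset.univ.erase s, E t ^ m t)) ?_ ?_
      · rw [hwc, ← Finset.mul_prod_erase _ _ (Finset.mem_univ s)]
        congr 1
        simp only [map_zero, zero_mul, add_zero]
        ring
      · intro t
        have := hmem a (Function.update E s (E s + C t * A s)) (fun s' => by
          by_cases h : s' = s
          · subst h
            rw [Function.update_self]
            exact (hE.isHomogeneous s').add ((hA s' (Finset.mem_univ _)).C_mul t)
          · rw [Function.update_of_ne h]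
            exact hE.isHomogeneous s')
        rw [← Finset.mul_prod_erase _ _ (Finset.mem_univ s), Function.update_self] at this
        convert this using 2
        have hup : ∏ t' ∈ Finset.univ.erase s, Function.update E s (E s + C t * A s) t' ^ m t' =
            ∏ t' ∈ Finset.univ.erase s, E t' ^ m t' :=
          Finset.prod_congr rfl fun t' ht' => by
            rw [Function.update_of_ne (Finset.ne_of_mem_erase ht')]
        rw [hup]
        ring
    have hms : (m s : ℝ) ≠ 0 := by
      have := hm1 s
      positivity
    have : (∏ s, E s ^ (m s - 1)) * (A s * ∏ t ∈ Finset.univ.erase s, E t) =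
        ((m s : ℝ) * a)⁻¹ • ((m s : MvPolynomial (Fin 2) ℝ) * E s ^ (m s - 1) * A s *
        (C a * ∏ t ∈ Finset.univ.erase s, E t ^ m t)) := by
      have h1 : ∏ t ∈ Finset.univ.erase s, E t ^ m t =
          (∏ t ∈ Finset.univ.erase s, E t ^ (m t - 1)) * ∏ t ∈ Finset.univ.erase s, E t := by
        rw [← Finset.prod_mul_distrib]
        refine Finset.prod_congr rfl fun s _ => ?_
        rw [← pow_succ, Nat.sub_add_cancel (hm1 s)]
      rw [eq_inv_smul_iff₀ (mul_ne_zero hms ha), h1,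
        ← Finset.mul_prod_erase _ (fun s => E s ^ (m s - 1)) (Finset.mem_univ s), smul_eq_C_mul,
        C_mul, show (C (m s : ℝ) : MvPolynomial (Fin 2) ℝ) = (m s : MvPolynomial (Fin 2) ℝ) by
          simp]
      ring
    rw [this, map_smul]
    exact T.smul_mem _ key

/-! ### Compatible patterns -/

section Compatible

variable {L r c : ℕ}

lemma card_filter_eq_of_injective {m : ℕ} {f : Fin m → Fin L} (hf : Function.Injective f)
    (l : Fin L) : (Finset.univ.filter fun i => f i = l).card =
      if l ∈ Finset.univ.image f then 1 else 0 := by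
  split_ifs with h
  · obtain ⟨i, -, rfl⟩ := Finset.mem_image.1 h
    rw [Finset.card_eq_one]
    exact ⟨i, by ext j; simp [hf.eq_iff]⟩
  · rw [Finset.card_eq_zero, Finset.filter_eq_empty_iff]
    exact fun i hi hil => h (Finset.mem_image.2 ⟨i, hi, hil⟩)

/-- A compatible placement amounts to a choice, for every colour, of the set of bins that contain
a ball of this colour. -/
lemma compatible_iff (k : Fin L → ℕ) (ρ : Fin r → ℕ) (γ : Fin c → ℕ) :
    Compatible k ρ γ ↔ ∃ S : Fin r ⊕ Fin c → Finset (Fin L),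
      (∀ s, (S s).card = Sum.elim ρ γ s) ∧
      ∀ l, ∑ s ∈ Finset.univ.filter (fun s => l ∈ S s), factorDegree r c s ≤ k l - 1 := by
  constructor
  · rintro ⟨f, g, hf, hg, h⟩
    refine ⟨Sum.elim (fun i => Finset.univ.image (f i)) (fun j => Finset.univ.image (g j)), ?_, ?_⟩
    · rintro (i | j)
      · simp [Finset.card_image_of_injective _ (hf i)]
      · simp [Finset.card_image_of_injective _ (hg j)]
    · intro l
      refine le_trans (le_of_eq ?_) (h l)
      simp only [card_filter_eq_of_injective (hf _), card_filter_eq_of_injective (hg _),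
        Finset.sum_filter, Fintype.sum_sum_type, Sum.elim_inl, Sum.elim_inr, factorDegree,
        Finset.mul_sum, mul_ite, mul_one, mul_zero]
      congr!
  · rintro ⟨S, hS, h⟩
    have hf : ∀ i, (S (Sum.inl i)).card = ρ i := fun i => hS (Sum.inl i)
    have hg : ∀ j, (S (Sum.inr j)).card = γ j := fun j => hS (Sum.inr j)
    refine ⟨fun i => (S (Sum.inl i)).orderEmbOfFin (hf i),
      fun j => (S (Sum.inr j)).orderEmbOfFin (hg j), fun i => (RelEmbedding.injective _),
      fun j => (RelEmbedding.injective _), fun l => ?_⟩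
    refine le_trans (le_of_eq ?_) (h l)
    have hmem : ∀ (m : ℕ) (A : Finset (Fin L)) (hA : A.card = m),
        Finset.univ.image (A.orderEmbOfFin hA) = A := by
      intro m A hA
      rw [← Finset.coe_inj, Finset.coe_image, Finset.coe_univ, Set.image_univ,
        Finset.range_orderEmbOfFin]
    simp only [card_filter_eq_of_injective (RelEmbedding.injective _), hmem,
      Finset.sum_filter, Fintype.sum_sum_type, factorDegree, Sum.elim_inl, Sum.elim_inr,
      Finset.mul_sum, mul_ite, mul_one, mul_zero]

end Compatible

/-! ### Factorizations along the layers and critical parameters -/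

section Parameters

variable {L N r c : ℕ}

/-- Critical points on the multiple root locus lift to critical parameters if the pattern is
compatible with the architecture. -/
theorem exists_critical_of_compatible (hL : 0 < L) (d : Fin (L + 1) → ℕ) (k : Fin L → ℕ)
    (hk : ∀ l, 1 ≤ k l) (hd : ∀ l : Fin L, d l.succ + k l = d l.castSucc + 1)
    (X : Matrix (Fin (d 0)) (Fin N) ℝ) (Y : Matrix (Fin (d (Fin.last L))) (Fin N) ℝ)
    {ρ : Fin r → ℕ} {γ : Fin c → ℕ} (hρ : ∀ i, 1 ≤ ρ i) (hγ : ∀ j, 1 ≤ γ j)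
    (hn : ∑ i, patternPartition ρ γ i = endDegree k) (hcomp : Compatible k ρ γ)
    {w : Fin (endDegree k + 1) → ℝ}
    (hw : w ∈ critOn (filterLoss X Y : (Fin (endDegree k + 1) → ℝ) → ℝ)
      (filterPoly ⁻¹' multipleRootLocus (patternPartition ρ γ)))
    (hP : HasRrmp ρ γ (filterPoly w)) :
    ∃ θ : Params k, paramMap d k θ = convMatrix w ∧ IsCritical (paramLoss d k X Y) θ := by
  classical
  obtain ⟨T, hT, f', hf', hf'T⟩ := hw
  obtain rfl := hf'.unique (hasFDerivAt_filterLoss X Y w)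
  obtain ⟨a, E, ha, hE, hwE⟩ := hP.exists_isFactorFamily
  obtain ⟨S, hS, hSle⟩ := (compatible_iff k ρ γ).1 hcomp
  have hn' := hn
  rw [sum_patternPartition] at hn'
  set B : Fin L → Finset (Fin r ⊕ Fin c) := fun l => Finset.univ.filter (fun s => l ∈ S s) with hB
  -- The total size of the balls equals the total capacity, so every bin is filled exactly.
  have hBdeg : ∀ l, ∑ s ∈ B l, factorDegree r c s = k l - 1 := by
    have htot : ∑ l, ∑ s ∈ B l, factorDegree r c s = ∑ l, (k l - 1) := by
      rw [← endDegree, ← hn']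
      simp only [hB, Finset.sum_filter]
      rw [Finset.sum_comm]
      refine Finset.sum_congr rfl fun s _ => ?_
      rw [Finset.sum_ite_mem, Finset.univ_inter, Finset.sum_const, hS, smul_eq_mul, mul_comm]
    exact fun l => (Finset.sum_eq_sum_iff_of_le fun l _ => hSle l).1 htot l (Finset.mem_univ l)
  set P : Fin L → MvPolynomial (Fin 2) ℝ := fun l => ∏ s ∈ B l, E s with hPdef
  have hPhom : ∀ l, (P l).IsHomogeneous (k l - 1) := fun l => by
    rw [← hBdeg l]
    exact IsHomogeneous.prod _ _ _ fun s _ => hE.isHomogeneous s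
  have hPne : ∀ l, P l ≠ 0 := fun l =>
    Finset.prod_ne_zero_iff.2 fun s _ => (hE.irreducible s).ne_zero
  have hPprod : ∏ l, P l = ∏ s, E s ^ Sum.elim ρ γ s := by
    simp only [hPdef, hB, Finset.prod_filter]
    rw [Finset.prod_comm]
    refine Finset.prod_congr rfl fun s _ => ?_
    rw [Finset.prod_ite_mem, Finset.univ_inter, Finset.prod_const, hS]
  -- The scalar `a` has to go into one layer; the first is chosen, which exists as `0 < L`.
  let b : Fin L → ℝ := fun l => if l = ⟨0, hL⟩ then a else 1
  have hb : ∀ l, b l ≠ 0 := fun l => by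
    simp only [b]
    split_ifs
    · exact ha
    · exact one_ne_zero
  have hbprod : ∏ l, b l = a := by simp [b]
  let θ : Params k := fun l => coeffs (k l) (C (b l) * P l)
  have hθ : ∀ l, formOf (k l) (θ l) = C (b l) * P l := fun l =>
    formOf_coeffs (hk l) ((hPhom l).C_mul _)
  have hend : endFilter k θ = w := by
    rw [endFilter_apply, Finset.prod_congr rfl fun l _ => hθ l, Finset.prod_mul_distrib,
      ← map_prod, hbprod, hPprod, ← hwE, filterPoly_eq, coeffs_formOf]
  refine ⟨θ, by rw [paramMap_eq d k hk hd, hend], ?_⟩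
  rw [isCritical_paramLoss_iff d k hk hd]
  intro η
  rw [hend, endFilterDeriv_apply]
  refine hf'T _ (T.sum_mem fun l _ => ?_)
  have hm1 : ∀ s, 1 ≤ Sum.elim ρ γ s := by
    rintro (i | j)
    · exact hρ i
    · exact hγ j
  -- Each `E s` occurs at most once in `P l`, so the product of the other layers keeps at least `m s
  -- - 1` copies of it.
  have hrest : ∏ l' ∈ Finset.univ.erase l, formOf (k l') (θ l') =
      C (a / b l) * ((∏ s, E s ^ (Sum.elim ρ γ s - 1)) * ∏ s ∈ (B l)ᶜ, E s) := by
    have h1 : (C (b l) * P l) * ∏ l' ∈ Finset.univ.erase l, formOf (k l') (θ l') =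
        C a * ∏ s, E s ^ Sum.elim ρ γ s := by
      rw [← hθ l, Finset.mul_prod_erase _ (fun l => formOf (k l) (θ l)) (Finset.mem_univ l),
        ← hwE, filterPoly_eq, ← hend, formOf_endFilter]
    have h2 : ∏ s, E s ^ Sum.elim ρ γ s =
        (∏ s, E s ^ (Sum.elim ρ γ s - 1)) * (P l * ∏ s ∈ (B l)ᶜ, E s) := by
      rw [hPdef, Finset.prod_mul_prod_compl, ← Finset.prod_mul_distrib]
      refine Finset.prod_congr rfl fun s _ => ?_
      rw [← pow_succ, Nat.sub_add_cancel (hm1 s)]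
    have h3 : C (b l) * P l ≠ 0 := mul_ne_zero (by simpa using hb l) (hPne l)
    apply mul_left_cancel₀ h3
    rw [h1, h2]
    have h4 : (C a : MvPolynomial (Fin 2) ℝ) = C (b l) * C (a / b l) := by
      rw [← C_mul, mul_div_cancel₀ _ (hb l)]
    rw [h4]
    ring
  rw [hrest]
  have hQ : (C (a / b l) * (formOf (k l) (η l) * ∏ s ∈ (B l)ᶜ, E s)).IsHomogeneous
      (∑ s, factorDegree r c s) := by
    rw [← Finset.sum_add_sum_compl (B l), hBdeg l]
    exact ((isHomogeneous_formOf (k l) (η l)).mul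
      (IsHomogeneous.prod _ _ _ fun s _ => hE.isHomogeneous s)).C_mul _
  have := tangent_contains_multiples hρ hγ hn hT ha hE hwE hQ
  convert this using 2
  ring

lemma IsFactorFamily.not_dvd {E : Fin r ⊕ Fin c → MvPolynomial (Fin 2) ℝ} (hE : IsFactorFamily E)
    {a : ℝ} (ha : a ≠ 0) (m : Fin r ⊕ Fin c → ℕ) (s : Fin r ⊕ Fin c) :
    ¬ E s ^ (m s + 1) ∣ C a * ∏ s, E s ^ m s := by
  intro h
  rw [← Finset.mul_prod_erase _ _ (Finset.mem_univ s), mul_left_comm, pow_succ,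
    mul_dvd_mul_iff_left (pow_ne_zero _ (hE.irreducible s).ne_zero)] at h
  have h1 : IsRelPrime (E s) (C a * ∏ t ∈ Finset.univ.erase s, E t ^ m t) := by
    refine IsRelPrime.mul_right ?_ (IsRelPrime.prod_right fun t ht =>
      IsRelPrime.pow_right (hE.isRelPrime s t (Finset.ne_of_mem_erase ht).symm))
    exact fun x _ hx => isUnit_of_dvd_unit hx (isUnit_iff_exists_C.2 ⟨a, ha, rfl⟩)
  exact (hE.irreducible s).not_isUnit (h1 dvd_rfl h)

lemma emultiplicity_eq_ite {α : Type*} [CommMonoidWithZero α] {p x : α} [Decidable (p ∣ x)]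
    (h : ¬ p ^ 2 ∣ x) : emultiplicity p x = if p ∣ x then 1 else 0 := by
  split_ifs with h1
  · exact emultiplicity_eq_coe (n := 1).2 ⟨by simpa using h1, h⟩
  · exact emultiplicity_eq_zero.2 h1

/-- If the pattern is not compatible with the architecture, then in every factorization along the
layers some layer is divisible by the square of an irreducible factor. -/
lemma exists_sq_dvd_of_not_compatible {k : Fin L → ℕ} {ρ : Fin r → ℕ} {γ : Fin c → ℕ}
    (hcomp : ¬ Compatible k ρ γ) {a : ℝ} {E : Fin r ⊕ Fin c → MvPolynomial (Fin 2) ℝ}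
    (ha : a ≠ 0) (hE : IsFactorFamily E) {P : Fin L → MvPolynomial (Fin 2) ℝ}
    (hPhom : ∀ l, (P l).IsHomogeneous (k l - 1))
    (hP : ∏ l, P l = C a * ∏ s, E s ^ Sum.elim ρ γ s) : ∃ s l, E s ^ 2 ∣ P l := by
  classical
  by_contra! hno
  apply hcomp
  rw [compatible_iff]
  -- Colour `s` goes into the layers divisible by `E s`. Without square divisors their number is the
  -- multiplicity of `E s` in the product, and coprimality makes the factors within one layer fit
  -- its degree.
  refine ⟨fun s => Finset.univ.filter fun l => E s ∣ P l, fun s => ?_, fun l => ?_⟩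
  · have h1 : emultiplicity (E s) (∏ l, P l) =
        ((Finset.univ.filter fun l => E s ∣ P l).card : ℕ) := by
      rw [Finset.emultiplicity_prod (hE.irreducible s).prime,
        Finset.sum_congr rfl fun l _ => emultiplicity_eq_ite (hno s l)]
      simp
    have h2 : emultiplicity (E s) (∏ l, P l) = (Sum.elim ρ γ s : ℕ) := by
      rw [hP, emultiplicity_eq_coe]
      exact ⟨Dvd.dvd.mul_left (Finset.dvd_prod_of_mem (fun s => E s ^ Sum.elim ρ γ s)
        (Finset.mem_univ s)) _, hE.not_dvd ha _ s⟩
    exact_mod_cast h1.symm.trans h2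
  · have hPl : P l ≠ 0 := by
      have : ∏ l, P l ≠ 0 := by
        rw [hP]
        exact mul_ne_zero (by simpa using ha) (Finset.prod_ne_zero_iff.2 fun s _ =>
          pow_ne_zero _ (hE.irreducible s).ne_zero)
      exact Finset.prod_ne_zero_iff.1 this l (Finset.mem_univ l)
    have hdvd : ∏ s ∈ Finset.univ.filter (fun s => E s ∣ P l), E s ∣ P l :=
      Finset.prod_dvd_of_isRelPrime (fun s _ t _ hst => hE.isRelPrime s t hst)
        fun s hs => (Finset.mem_filter.1 hs).2
    have hne : ∏ s ∈ Finset.univ.filter (fun s => E s ∣ P l), E s ≠ 0 :=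
      ne_zero_of_dvd_ne_zero hPl hdvd
    simp only [Finset.mem_filter, Finset.mem_univ, true_and]
    rw [← (hPhom l).totalDegree hPl,
      ← (IsHomogeneous.prod _ _ _ fun s _ => hE.isHomogeneous s).totalDegree hne]
    exact totalDegree_le_of_dvd_of_isDomain hdvd hPl

/-- At a critical parameter with a layer divisible by `E s₀ ^ 2`, the differential of the loss
vanishes on all multiples of `∏ E s ^ (m s - 1) / E s₀`. -/
lemma filterLossDeriv_eq_zero_of_sq_dvd {d : Fin (L + 1) → ℕ} {k : Fin L → ℕ}
    (hk : ∀ l, 1 ≤ k l) (hd : ∀ l : Fin L, d l.succ + k l = d l.castSucc + 1)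
    {X : Matrix (Fin (d 0)) (Fin N) ℝ} {Y : Matrix (Fin (d (Fin.last L))) (Fin N) ℝ}
    {θ : Params k} (hθ : IsCritical (paramLoss d k X Y) θ)
    {a : ℝ} {E : Fin r ⊕ Fin c → MvPolynomial (Fin 2) ℝ} (ha : a ≠ 0) (hE : IsFactorFamily E)
    {m : Fin r ⊕ Fin c → ℕ} (hm : ∀ s, 1 ≤ m s)
    (hP : ∏ l, formOf (k l) (θ l) = C a * ∏ s, E s ^ m s) {s₀ : Fin r ⊕ Fin c} {l₀ : Fin L}
    (hs₀ : E s₀ ^ 2 ∣ formOf (k l₀) (θ l₀)) {Q : MvPolynomial (Fin 2) ℝ}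
    (hQ : Q.IsHomogeneous (∑ s, factorDegree r c s * if s = s₀ then 2 else 1)) :
    2 ≤ m s₀ ∧ filterLossDeriv X Y (endFilter k θ) (coeffs (endDegree k + 1)
      ((∏ s, E s ^ (m s - if s = s₀ then 2 else 1)) * Q)) = 0 := by
  classical
  set e : Fin r ⊕ Fin c → ℕ := fun s => if s = s₀ then 2 else 1 with he
  have hPne : ∏ l, formOf (k l) (θ l) ≠ 0 := by
    rw [hP]
    exact mul_ne_zero (by simpa using ha) (Finset.prod_ne_zero_iff.2 fun s _ =>
      pow_ne_zero _ (hE.irreducible s).ne_zero)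
  have hPl : ∀ l, formOf (k l) (θ l) ≠ 0 := fun l =>
    Finset.prod_ne_zero_iff.1 hPne l (Finset.mem_univ l)
  have hm₀ : 2 ≤ m s₀ := by
    by_contra hlt
    refine hE.not_dvd ha m s₀ ?_
    rw [← hP]
    exact ((pow_dvd_pow _ (by omega)).trans hs₀).trans
      (Finset.dvd_prod_of_mem (fun l => formOf (k l) (θ l)) (Finset.mem_univ l₀))
  refine ⟨hm₀, ?_⟩
  have hem : ∀ s, e s ≤ m s := fun s => by
    simp only [he]
    split_ifs with h
    · rwa [h]
    · exact hm s
  have hFhom : ∀ s, (E s ^ e s).IsHomogeneous (factorDegree r c s * e s) := fun s =>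
    (hE.isHomogeneous s).pow _
  have hFne : ∀ s, E s ^ e s ≠ 0 := fun s => pow_ne_zero _ (hE.irreducible s).ne_zero
  -- The square of `E s₀` sits in the layer `l₀` by hypothesis; any other factor is prime and hence
  -- divides some layer.
  have hFdvd : ∀ s, ∃ l, E s ^ e s ∣ formOf (k l) (θ l) := fun s => by
    by_cases h : s = s₀
    · subst h
      exact ⟨l₀, by simpa [he] using hs₀⟩
    · have h1 : E s ∣ ∏ l, formOf (k l) (θ l) := by
        rw [hP]
        exact Dvd.dvd.mul_left ((dvd_pow_self _ (by have := hm s; omega)).trans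
          (Finset.dvd_prod_of_mem (fun s => E s ^ m s) (Finset.mem_univ s))) _
      obtain ⟨l, -, hl⟩ := ((hE.irreducible s).prime.dvd_finsetProd_iff _).1 h1
      exact ⟨l, by simpa [he, h] using hl⟩
  set G := ∏ s, E s ^ (m s - e s) with hG
  have hGF : ∏ s, E s ^ m s = G * ∏ s, E s ^ e s := by
    rw [hG, ← Finset.prod_mul_distrib]
    refine Finset.prod_congr rfl fun s _ => ?_
    rw [← pow_add, Nat.sub_add_cancel (hem s)]
  have key : ∀ s (A : MvPolynomial (Fin 2) ℝ), A.IsHomogeneous (factorDegree r c s * e s) →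
      filterLossDeriv X Y (endFilter k θ) (coeffs (endDegree k + 1)
        (G * (A * ∏ t ∈ Finset.univ.erase s, E t ^ e t))) = 0 := by
    intro s A hA
    obtain ⟨l, hl⟩ := hFdvd s
    have hdeg : factorDegree r c s * e s ≤ k l - 1 := by
      rw [← (hFhom s).totalDegree (hFne s),
        ← (isHomogeneous_formOf (k l) (θ l)).totalDegree (hPl l)]
      exact totalDegree_le_of_dvd_of_isDomain hl (hPl l)
    obtain ⟨m', hm'⟩ := Nat.exists_eq_add_of_le hdeg
    obtain ⟨D, hD, hPD⟩ := exists_isHomogeneous_mul_eq (hFhom s)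
      (by rw [← hm']; exact isHomogeneous_formOf (k l) (θ l)) hl
    have hrest : D * ∏ l' ∈ Finset.univ.erase l, formOf (k l') (θ l') =
        C a * (G * ∏ t ∈ Finset.univ.erase s, E t ^ e t) := by
      apply mul_left_cancel₀ (hFne s)
      have h1 := Finset.mul_prod_erase Finset.univ (fun l => formOf (k l) (θ l))
        (Finset.mem_univ l)
      rw [hP, hGF, ← Finset.mul_prod_erase Finset.univ (fun s => E s ^ e s)
        (Finset.mem_univ s)] at h1
      simp only [hPD] at h1
      linear_combination h1
    -- Only layer `l` is varied, by exchanging its factor `E s ^ e s` for an arbitrary form `A` of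
    -- the same degree.
    have hcrit := (isCritical_paramLoss_iff d k hk hd X Y θ).1 hθ
      (Pi.single l (coeffs (k l) (A * D)))
    rw [endFilterDeriv_apply, Finset.sum_eq_single l, Pi.single_eq_same,
      formOf_coeffs (hk l) (by rw [hm']; exact hA.mul hD), mul_assoc, hrest] at hcrit
    · have h2 : A * (C a * (G * ∏ t ∈ Finset.univ.erase s, E t ^ e t)) =
          a • (G * (A * ∏ t ∈ Finset.univ.erase s, E t ^ e t)) := by
        rw [smul_eq_C_mul]
        ring
      rw [h2, map_smul, map_smul, smul_eq_mul] at hcrit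
      exact (mul_eq_zero.1 hcrit).resolve_left ha
    · intro l' _ hl'
      rw [Pi.single_eq_of_ne hl', map_zero, zero_mul, map_zero]
    · simp
  obtain ⟨b, A, hA, rfl⟩ := exists_sum_of_pairwise_isRelPrime Finset.univ (fun s => E s ^ e s)
    (fun s => factorDegree r c s * e s) (fun s _ => hFhom s) (fun s _ => hFne s)
    (fun s _ t _ hst => (hE.isRelPrime s t hst).pow) hQ
  -- The remaining term `C b * ∏ E s ^ e s` is itself of the form treated by `key`, with `A = C b *
  -- E s₀ ^ e s₀`.
  rw [mul_add, Finset.mul_sum, map_add, map_add, map_sum, map_sum,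
    Finset.sum_eq_zero fun s _ => key s (A s) (hA s (Finset.mem_univ s)), add_zero,
    ← Finset.mul_prod_erase Finset.univ (fun s => E s ^ e s) (Finset.mem_univ s₀), ← mul_assoc (C b)]
  exact key s₀ _ ((hFhom s₀).C_mul b)

end Parameters

end Forms

/-! ### Polynomial relations from a parameter count -/

section Relations

/-- The `y i` are values at `s` of polynomials in `card ι` variables. More such polynomials than the
transcendence degree are algebraically dependent, and their relation survives evaluation at `s`,
whatever relations hold in `A`. -/
lemma exists_aeval_eq_zero_of_card_lt {A ι κ : Type} [CommRing A] [Algebra ℝ A] [Fintype ι]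
    [Fintype κ] (s : ι → A) (y : κ → A) (hy : ∀ i, y i ∈ Algebra.adjoin ℝ (Set.range s))
    (hcard : Fintype.card ι < Fintype.card κ) :
    ∃ H : MvPolynomial κ ℝ, H ≠ 0 ∧ MvPolynomial.aeval y H = 0 := by
  rw [Algebra.adjoin_range_eq_range_aeval] at hy
  choose f hf using fun i => AlgHom.mem_range _ |>.1 (hy i)
  have hdep : ¬ AlgebraicIndependent ℝ f := by
    intro h
    have := h.cardinalMk_le_trdeg
    rw [MvPolynomial.trdeg_of_isDomain] at this
    simp only [Cardinal.mk_fintype, Cardinal.lift_natCast, Nat.cast_le] at this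
    omega
  rw [algebraicIndependent_iff] at hdep
  push Not at hdep
  obtain ⟨H, h0, hH⟩ := hdep
  refine ⟨H, hH, ?_⟩
  have : y = fun i => MvPolynomial.aeval s (f i) := funext fun i => (hf i).symm
  rw [this, ← MvPolynomial.comp_aeval_apply, h0, map_zero]

/-- Families of polynomials whose coefficients, as functions of the parameter, lie in a given
algebra of functions. -/
def polyFamily {Ω : Type*} (B : Subalgebra ℝ (Ω → ℝ)) : Subalgebra ℝ (Ω → Polynomial ℝ) where
  carrier := {p | ∀ i, (fun ξ => (p ξ).coeff i) ∈ B}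
  mul_mem' := by
    intro p q hp hq i
    simp only [Pi.mul_apply, Polynomial.coeff_mul]
    have h : (fun ξ => ∑ x ∈ Finset.HasAntidiagonal.antidiagonal i, (p ξ).coeff x.1 * (q ξ).coeff x.2) =
        ∑ x ∈ Finset.HasAntidiagonal.antidiagonal i,
          (fun ξ => (p ξ).coeff x.1) * (fun ξ => (q ξ).coeff x.2) := by
      funext ξ
      simp
    rw [h]
    exact B.sum_mem fun x _ => B.mul_mem (hp x.1) (hq x.2)
  add_mem' := by
    intro p q hp hq i
    simp only [Pi.add_apply, Polynomial.coeff_add]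
    exact B.add_mem (hp i) (hq i)
  algebraMap_mem' := by
    intro t i
    have h : (fun ξ => (algebraMap ℝ (Ω → Polynomial ℝ) t ξ).coeff i) =
        algebraMap ℝ (Ω → ℝ) (if i = 0 then t else 0) := by
      funext ξ
      simp [Polynomial.algebraMap_eq, Polynomial.coeff_C]
    rw [h]
    exact B.algebraMap_mem _

lemma C_mem_polyFamily {Ω : Type*} {B : Subalgebra ℝ (Ω → ℝ)} {f : Ω → ℝ} (hf : f ∈ B) :
    (fun ξ => Polynomial.C (f ξ)) ∈ polyFamily B := by
  intro i
  by_cases hi : i = 0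
  · simpa [Polynomial.coeff_C, hi] using hf
  · simp only [Polynomial.coeff_C, hi, if_false]
    exact B.zero_mem

lemma const_mem_polyFamily {Ω : Type*} (B : Subalgebra ℝ (Ω → ℝ)) (q : Polynomial ℝ) :
    (fun _ => q) ∈ polyFamily B :=
  fun i => B.algebraMap_mem (q.coeff i)

/-- A sequence annihilated by a linear recurrence is determined polynomially by those of its
entries that the recurrence leaves free. -/
lemma mem_of_recurrence {A : Type*} [CommRing A] [Algebra ℝ A] (B : Subalgebra ℝ A) {n g z : ℕ}
    (hzg : z ≤ g) (hgn : g ≤ n) (q x : ℕ → A) (hq : ∀ i, q i ∈ B) (hq0 : ∀ i < z, q i = 0)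
    (hqz : q z = 1)
    (hrec : ∀ j ≤ n - g, ∑ i ∈ Finset.range (g + 1), q i * x (j + i) = 0)
    (hlow : ∀ i < z, x i ∈ B) (hhigh : ∀ i ≤ n, n - g + z < i → x i ∈ B) :
    ∀ i ≤ n, x i ∈ B := by
  intro i hi
  -- Downward induction on `i`: the recurrence at `j = i - z` has lowest coefficient `q z = 1`, so
  -- `x i` is expressed through later entries without division. The first `z` and the last `g - z`
  -- entries stay free.
  induction h : n - i using Nat.strong_induction_on generalizing i with
  | _ t ih =>
    by_cases h1 : i < z
    · exact hlow i h1
    by_cases h2 : n - g + z < i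
    · exact hhigh i hi h2
    have hr := hrec (i - z) (by omega)
    rw [← Finset.add_sum_erase _ _ (Finset.mem_range.2 (show z < g + 1 by omega)), hqz, one_mul,
      Nat.sub_add_cancel (by omega)] at hr
    rw [eq_neg_of_add_eq_zero_left hr]
    refine B.neg_mem (B.sum_mem fun i' hi' => ?_)
    obtain ⟨hne, hlt⟩ := Finset.mem_erase.1 hi'
    rw [Finset.mem_range] at hlt
    rcases lt_or_gt_of_ne hne with h3 | h3
    · rw [hq0 i' h3, zero_mul]
      exact B.zero_mem
    · exact B.mul_mem (hq i') (ih (n - (i - z + i')) (by omega) _ (by omega) rfl)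

end Relations

/-! ### Normalized factors -/

section Normalized

open Polynomial

variable {r c : ℕ}

/-- Dehomogenizations of normalized linear and quadratic forms; `Z` is the set of the linear forms
that are multiples of `y`. -/
noncomputable def normPoly (Z : Finset (Fin r)) (τ : Fin r ⊕ (Fin c ⊕ Fin c) → ℝ) :
    Fin r ⊕ Fin c → ℝ[X] :=
  Sum.elim (fun i => if i ∈ Z then X else 1 + C (τ (Sum.inl i)) * X)
    (fun j => 1 + C (τ (Sum.inr (Sum.inl j))) * X + C (τ (Sum.inr (Sum.inr j))) * X ^ 2)

lemma natDegree_normPoly_le (Z : Finset (Fin r)) (τ : Fin r ⊕ (Fin c ⊕ Fin c) → ℝ)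
    (s : Fin r ⊕ Fin c) : (normPoly Z τ s).natDegree ≤ factorDegree r c s := by
  rcases s with i | j
  · simp only [normPoly, factorDegree, Sum.elim_inl]
    split_ifs
    · exact natDegree_X_le
    · compute_degree
  · simp only [normPoly, factorDegree, Sum.elim_inr]
    compute_degree

lemma natDegree_prod_normPoly_le (Z : Finset (Fin r)) (τ : Fin r ⊕ (Fin c ⊕ Fin c) → ℝ)
    (e : Fin r ⊕ Fin c → ℕ) :
    (∏ s, normPoly Z τ s ^ e s).natDegree ≤ ∑ s, factorDegree r c s * e s := by
  refine (natDegree_prod_le _ _).trans (Finset.sum_le_sum fun s _ => ?_)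
  rw [mul_comm]
  exact natDegree_pow_le.trans (Nat.mul_le_mul_left _ (natDegree_normPoly_le Z τ s))

/-- Factors in `Z` contribute powers of `X` and all others have constant coefficient `1`. The lowest
coefficient is thus `1` in a degree independent of `τ`, as `mem_of_recurrence` needs. -/
lemma exists_prod_normPoly_eq (Z : Finset (Fin r)) (τ : Fin r ⊕ (Fin c ⊕ Fin c) → ℝ)
    (e : Fin r ⊕ Fin c → ℕ) :
    ∃ q : ℝ[X], ∏ s, normPoly Z τ s ^ e s = X ^ (∑ i ∈ Z, e (Sum.inl i)) * (1 + X * q) := by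
  have key : ∀ p : ℝ[X], p.coeff 0 = 1 ↔ ∃ q, p = 1 + X * q := by
    intro p
    constructor
    · intro h
      refine ⟨p.divX, ?_⟩
      conv_lhs => rw [← X_mul_divX_add p, h, C_1]
      ring
    · rintro ⟨q, rfl⟩
      simp
  let R : ℝ[X] := (∏ i ∈ Zᶜ, normPoly Z τ (Sum.inl i) ^ e (Sum.inl i)) *
    ∏ j, normPoly Z τ (Sum.inr j) ^ e (Sum.inr j)
  have hR : R.coeff 0 = 1 := by
    rw [coeff_zero_eq_eval_zero, eval_mul, eval_prod, eval_prod, Finset.prod_eq_one,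
      Finset.prod_eq_one, one_mul]
    · intro j _
      simp [normPoly]
    · intro i hi
      simp [normPoly, Finset.mem_compl.1 hi]
  obtain ⟨q, hq⟩ := (key R).1 hR
  refine ⟨q, ?_⟩
  rw [← hq, Fintype.prod_sum_type, ← Finset.prod_mul_prod_compl Z, mul_assoc]
  congr 1
  rw [← Finset.prod_pow_eq_pow_sum]
  exact Finset.prod_congr rfl fun i hi => by simp [normPoly, hi]

lemma normPoly_mem_polyFamily {Ω : Type*} {B : Subalgebra ℝ (Ω → ℝ)} (Z : Finset (Fin r))
    {τ : Ω → Fin r ⊕ (Fin c ⊕ Fin c) → ℝ} (hτ : ∀ i, (fun ξ => τ ξ i) ∈ B)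
    (s : Fin r ⊕ Fin c) : (fun ξ => normPoly Z (τ ξ) s) ∈ polyFamily B := by
  have hX := const_mem_polyFamily B (X : ℝ[X])
  rcases s with i | j
  · simp only [normPoly, Sum.elim_inl]
    split_ifs
    · exact hX
    · exact (polyFamily B).add_mem (polyFamily B).one_mem
        ((polyFamily B).mul_mem (C_mem_polyFamily (hτ _)) hX)
  · simp only [normPoly, Sum.elim_inr]
    exact (polyFamily B).add_mem ((polyFamily B).add_mem (polyFamily B).one_mem
        ((polyFamily B).mul_mem (C_mem_polyFamily (hτ _)) hX))
      ((polyFamily B).mul_mem (C_mem_polyFamily (hτ _)) ((polyFamily B).pow_mem hX 2))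

lemma prod_normPoly_mem_polyFamily {Ω : Type*} {B : Subalgebra ℝ (Ω → ℝ)} (Z : Finset (Fin r))
    {τ : Ω → Fin r ⊕ (Fin c ⊕ Fin c) → ℝ} (hτ : ∀ i, (fun ξ => τ ξ i) ∈ B)
    (e : Fin r ⊕ Fin c → ℕ) : (fun ξ => ∏ s, normPoly Z (τ ξ) s ^ e s) ∈ polyFamily B := by
  have h : (fun ξ => ∏ s, normPoly Z (τ ξ) s ^ e s) =
      ∏ s, (fun ξ => normPoly Z (τ ξ) s) ^ e s := by
    funext ξ
    simp
  rw [h]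
  exact (polyFamily B).prod_mem fun s _ =>
    (polyFamily B).pow_mem (normPoly_mem_polyFamily Z hτ s) _

end Normalized

/-! ### The data as functions of the differential of the loss -/

section Data

variable {M D N n : ℕ}

lemma outputEntry_eq_sum (hD : M + n = D) (X : Matrix (Fin D) (Fin N) ℝ) (i : Fin M) (j : Fin N)
    (w : Fin (n + 1) → ℝ) :
    outputEntry X i j w = ∑ t : Fin (n + 1), w t * X ⟨i + t, by omega⟩ j := by
  rw [outputEntry_apply, Matrix.mul_apply]
  simp only [convMatrix, Finset.sum_mul]
  rw [Finset.sum_comm]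
  refine Finset.sum_congr rfl fun t _ => ?_
  rw [Finset.sum_eq_single ⟨i + t, by omega⟩]
  · simp
  · intro b _ hb
    rw [if_neg (fun h => hb (Fin.ext h)), zero_mul]
  · simp

/-- The linear part of the square loss in function space. -/
def dataVector (hD : M + n = D) (X : Matrix (Fin D) (Fin N) ℝ) (Y : Matrix (Fin M) (Fin N) ℝ)
    (t : Fin (n + 1)) : ℝ :=
  ∑ i : Fin M, ∑ j : Fin N, Y i j * X ⟨i + t, by omega⟩ j

/-- Half the `t`-th partial derivative of the loss is a term polynomial in `X` and `w` minus
`dataVector`. The latter is therefore polynomial in `X`, the filter and the differential. -/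
lemma dataVector_eq (hD : M + n = D) (X : Matrix (Fin D) (Fin N) ℝ)
    (Y : Matrix (Fin M) (Fin N) ℝ) (w : Fin (n + 1) → ℝ) (t : Fin (n + 1)) :
    dataVector hD X Y t = (∑ i : Fin M, ∑ j : Fin N, (∑ t' : Fin (n + 1),
      w t' * X ⟨i + t', by omega⟩ j) * X ⟨i + t, by omega⟩ j) -
      2⁻¹ * filterLossDeriv X Y w (Pi.single t 1) := by
  have h1 : ∀ (i : Fin M) (j : Fin N),
      outputEntry X i j (Pi.single t 1 : Fin (n + 1) → ℝ) = X ⟨i + t, by omega⟩ j := by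
    intro i j
    rw [outputEntry_eq_sum hD]
    simp [Pi.single_apply]
  simp only [filterLossDeriv, _root_.sum_apply, _root_.smul_apply, h1,
    outputEntry_eq_sum hD _ _ _ w, smul_eq_mul, dataVector, Finset.mul_sum,
    ← Finset.sum_sub_distrib]
  refine Finset.sum_congr rfl fun i _ => Finset.sum_congr rfl fun j _ => ?_
  ring

/-- A nonzero polynomial in `X` and the linear part of the loss is a nonzero polynomial in the
data. -/
lemma forGenericData_of_relation (hM : 1 ≤ M) (hN : D ≤ N) (hD : M + n = D)
    (H : MvPolynomial ((Fin D × Fin N) ⊕ Fin (n + 1)) ℝ) (hH : H ≠ 0) :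
    ForGenericData M D N fun X Y => MvPolynomial.eval
      (Sum.elim (fun p : Fin D × Fin N => X p.1 p.2) (dataVector hD X Y)) H ≠ 0 := by
  let b : Fin (n + 1) → MvPolynomial ((Fin D × Fin N) ⊕ (Fin M × Fin N)) ℝ := fun t =>
    ∑ i : Fin M, ∑ j : Fin N, MvPolynomial.X (Sum.inr (i, j)) *
      MvPolynomial.X (Sum.inl (⟨i + t, by omega⟩, j))
  let F : MvPolynomial ((Fin D × Fin N) ⊕ (Fin M × Fin N)) ℝ :=
    MvPolynomial.bind₁ (Sum.elim (fun p => MvPolynomial.X (Sum.inl p)) b) H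
  have hF : ∀ (X : Matrix (Fin D) (Fin N) ℝ) (Y : Matrix (Fin M) (Fin N) ℝ),
      MvPolynomial.eval (Sum.elim (fun a => X a.1 a.2) (fun b => Y b.1 b.2)) F =
      MvPolynomial.eval
        (Sum.elim (fun p : Fin D × Fin N => X p.1 p.2) (dataVector hD X Y)) H := by
    intro X Y
    simp only [F]
    rw [← MvPolynomial.coe_aeval_eq_eval, ← MvPolynomial.coe_aeval_eq_eval, RingHom.coe_coe,
      RingHom.coe_coe, MvPolynomial.aeval_bind₁]
    congr 2
    funext p
    rcases p with p | t
    · simp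
    · simp [b, dataVector]
  refine ⟨F, ?_, fun X Y h => by
    rw [hF] at h
    exact h⟩
  intro hF0
  have hnD : n + 1 ≤ D := by omega
  have hnN : n + 1 ≤ N := by omega
  let emb : Fin (n + 1) × Fin (n + 1) → (Fin D × Fin N) ⊕ Fin (n + 1) := fun p =>
    Sum.inl (Fin.castLE hnD p.1, Fin.castLE hnN p.2)
  have hemb : Function.Injective emb := by
    rintro ⟨a, b⟩ ⟨a', b'⟩ h
    simpa [emb] using h
  -- Determinant of the upper left square block of size `n + 1` of `X`, which fits because `n + 1 ≤
  -- D ≤ N`. Where it is nonzero, `Y` can be chosen to give `dataVector` any prescribed value.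
  let Δ : MvPolynomial ((Fin D × Fin N) ⊕ Fin (n + 1)) ℝ :=
    MvPolynomial.rename emb (Matrix.det (Matrix.mvPolynomialX (Fin (n + 1)) (Fin (n + 1)) ℝ))
  have hΔ : Δ ≠ 0 := fun h => Matrix.det_mvPolynomialX_ne_zero (Fin (n + 1)) ℝ
    (MvPolynomial.rename_injective _ hemb (by rw [map_zero]; exact h))
  refine mul_ne_zero hH hΔ (MvPolynomial.funext fun v => ?_)
  rw [map_mul, map_zero]
  let X : Matrix (Fin D) (Fin N) ℝ := fun i j => v (Sum.inl (i, j))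
  let A : Matrix (Fin (n + 1)) (Fin (n + 1)) ℝ :=
    fun i j => X (Fin.castLE hnD i) (Fin.castLE hnN j)
  have hA : MvPolynomial.eval v Δ = A.det := by
    simp only [Δ]
    rw [MvPolynomial.eval_rename, RingHom.map_det]
    congr 1
    ext i j
    simp [emb, A, X, Matrix.mvPolynomialX]
  by_cases hdet : A.det = 0
  · rw [hA, hdet, mul_zero]
  · let y : Fin (n + 1) → ℝ := A⁻¹.mulVec fun t => v (Sum.inr t)
    have hy : A.mulVec y = fun t => v (Sum.inr t) := by
      rw [Matrix.mulVec_mulVec, Matrix.mul_nonsing_inv _ (isUnit_iff_ne_zero.2 hdet),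
        Matrix.one_mulVec]
    -- With `Y` supported on the first `n + 1` entries of its first row, `dataVector` becomes
    -- `A.mulVec y`.
    let Y : Matrix (Fin M) (Fin N) ℝ := fun i j =>
      if (i : ℕ) = 0 then (if h : (j : ℕ) < n + 1 then y ⟨j, h⟩ else 0) else 0
    have hb : dataVector hD X Y = fun t => v (Sum.inr t) := by
      rw [← hy]
      funext t
      rw [dataVector, Finset.sum_eq_single ⟨0, by omega⟩]
      · have hsub : ∑ j ∈ Finset.univ.image (Fin.castLE hnN),
            Y ⟨0, by omega⟩ j * X ⟨0 + t, by omega⟩ j =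
            ∑ j, Y ⟨0, by omega⟩ j * X ⟨0 + t, by omega⟩ j := by
          refine Finset.sum_subset (Finset.subset_univ _) fun j _ hj => ?_
          have : ¬ (j : ℕ) ≤ n := fun h =>
            hj (Finset.mem_image.2 ⟨⟨j, Nat.lt_succ_of_le h⟩, by simp, rfl⟩)
          simp [Y, this]
        rw [← hsub, Finset.sum_image (fun a _ b _ h => Fin.castLE_injective hnN h)]
        refine Finset.sum_congr rfl fun j _ => ?_
        have : (⟨0 + t, by omega⟩ : Fin D) = Fin.castLE hnD t := by ext; simp
        have hYj : Y ⟨0, by omega⟩ (Fin.castLE hnN j) = y j := by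
          simp [Y, Nat.lt_succ_iff.1 j.2]
        rw [hYj, this, mul_comm]
      · intro i _ hi
        refine Finset.sum_eq_zero fun j _ => ?_
        have : (i : ℕ) ≠ 0 := fun h => hi (Fin.ext h)
        simp [Y, this]
      · simp
    have hv : Sum.elim (fun p : Fin D × Fin N => X p.1 p.2) (dataVector hD X Y) = v := by
      rw [hb]
      funext p
      rcases p with p | t <;> rfl
    rw [← hv, ← hF X Y, hF0, map_zero, zero_mul]

end Data

/-! ### Degenerate configurations are not generic -/

section Generic

open Polynomial

variable {M D N n r c : ℕ}

/-- The filter of the form with normalized factors `normPoly Z τ`, exponents `m` and scalar `a`. -/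
noncomputable def normFilter (n : ℕ) (m : Fin r ⊕ Fin c → ℕ) (Z : Finset (Fin r)) (a : ℝ)
    (τ : Fin r ⊕ (Fin c ⊕ Fin c) → ℝ) : Fin (n + 1) → ℝ :=
  fun i => (C a * ∏ s, normPoly Z τ s ^ m s).coeff i

/-- The differential of the loss at a form with exponents `m` vanishes on all multiples of degree
`n` of the form with exponents `m - e`. -/
def IsDegenerate (X : Matrix (Fin D) (Fin N) ℝ) (Y : Matrix (Fin M) (Fin N) ℝ) (n : ℕ)
    (m e : Fin r ⊕ Fin c → ℕ) (Z : Finset (Fin r)) (a : ℝ)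
    (τ : Fin r ⊕ (Fin c ⊕ Fin c) → ℝ) : Prop :=
  ∀ j ≤ ∑ s, factorDegree r c s * e s, filterLossDeriv X Y (normFilter n m Z a τ)
    (fun i => ((∏ s, normPoly Z τ s ^ (m s - e s)) * Polynomial.X ^ j).coeff i) = 0

lemma normFilter_mem {Ω : Type*} {B : Subalgebra ℝ (Ω → ℝ)} (m : Fin r ⊕ Fin c → ℕ)
    (Z : Finset (Fin r)) {a : Ω → ℝ} (ha : a ∈ B) {τ : Ω → Fin r ⊕ (Fin c ⊕ Fin c) → ℝ}
    (hτ : ∀ i, (fun ξ => τ ξ i) ∈ B) (i : Fin (n + 1)) :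
    (fun ξ => normFilter n m Z (a ξ) (τ ξ) i) ∈ B :=
  (polyFamily B).mul_mem (C_mem_polyFamily ha) (prod_normPoly_mem_polyFamily Z hτ m) i

/-- Vanishing of the differential on the shifts `G * X ^ j` is a linear recurrence for its entries,
with the coefficients of `G`. -/
lemma filterLossDeriv_eq_sum_range (X : Matrix (Fin D) (Fin N) ℝ) (Y : Matrix (Fin M) (Fin N) ℝ)
    (w : Fin (n + 1) → ℝ) {G : ℝ[X]} {g j : ℕ} (hG : G.natDegree ≤ g) (hj : g + j ≤ n) :
    filterLossDeriv X Y w (fun i => (G * Polynomial.X ^ j).coeff i) =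
      ∑ i ∈ Finset.range (g + 1), G.coeff i *
        (if h : j + i < n + 1 then filterLossDeriv X Y w (Pi.single ⟨j + i, h⟩ 1) else 0) := by
  let x : ℕ → ℝ := fun i => if h : i < n + 1 then filterLossDeriv X Y w (Pi.single ⟨i, h⟩ 1) else 0
  have h1 : filterLossDeriv X Y w (fun i => (G * Polynomial.X ^ j).coeff i) =
      ∑ i ∈ Finset.range (n + 1), (G * Polynomial.X ^ j).coeff i * x i := by
    rw [Finset.sum_range]
    have hv : (fun i : Fin (n + 1) => (G * Polynomial.X ^ j).coeff i) =
        ∑ i : Fin (n + 1), (G * Polynomial.X ^ j).coeff i • (Pi.single i 1 : Fin (n + 1) → ℝ) :=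
      pi_eq_sum_univ' _
    rw [hv, map_sum]
    refine Finset.sum_congr rfl fun i _ => ?_
    rw [map_smul, smul_eq_mul]
    simp only [x, dif_pos i.2]
  have h2 : ∑ i ∈ Finset.Ico j (j + (g + 1)), (G * Polynomial.X ^ j).coeff i * x i =
      ∑ i ∈ Finset.range (n + 1), (G * Polynomial.X ^ j).coeff i * x i := by
    refine Finset.sum_subset (fun i hi => ?_) fun i _ hi => ?_
    · rw [Finset.mem_Ico] at hi
      rw [Finset.mem_range]
      omega
    · rw [coeff_mul_X_pow']
      split_ifs with hji
      · rw [Finset.mem_Ico] at hi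
        rw [coeff_eq_zero_of_natDegree_lt (by omega), zero_mul]
      · rw [zero_mul]
  rw [h1, ← h2, Finset.sum_Ico_eq_sum_range, Nat.add_sub_cancel_left]
  refine Finset.sum_congr rfl fun i _ => ?_
  rw [add_comm j i, coeff_mul_X_pow]

lemma coeff_X_pow_mul_one_add (z : ℕ) (q : ℝ[X]) :
    (∀ i < z, (Polynomial.X ^ z * (1 + Polynomial.X * q)).coeff i = 0) ∧
      (Polynomial.X ^ z * (1 + Polynomial.X * q)).coeff z = 1 := by
  constructor
  · intro i hi
    rw [coeff_X_pow_mul', if_neg (by omega)]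
  · rw [coeff_X_pow_mul', if_pos le_rfl, Nat.sub_self]
    simp

/-- A parameter count: for generic data there are no degenerate configurations. -/
theorem forGenericData_not_isDegenerate (hM : 1 ≤ M) (hN : D ≤ N) (hD : M + n = D)
    (m e : Fin r ⊕ Fin c → ℕ) (hem : ∀ s, e s ≤ m s)
    (hn : ∑ s, factorDegree r c s * m s = n)
    (he : ∑ s, factorDegree r c s < ∑ s, factorDegree r c s * e s) (Z : Finset (Fin r)) :
    ForGenericData M D N fun X Y => ¬ ∃ a τ, IsDegenerate X Y n m e Z a τ := by
  classical
  -- The incidence set of data and degenerate parameters; all quantities below are real functions on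
  -- it.
  let Ω : Type := {p : (Matrix (Fin D) (Fin N) ℝ × Matrix (Fin M) (Fin N) ℝ) ×
    (ℝ × (Fin r ⊕ (Fin c ⊕ Fin c) → ℝ)) // IsDegenerate p.1.1 p.1.2 n m e Z p.2.1 p.2.2}
  let g := ∑ s, factorDegree r c s * (m s - e s)
  let z := ∑ i ∈ Z, (m (Sum.inl i) - e (Sum.inl i))
  have hge : g + ∑ s, factorDegree r c s * e s = n := by
    rw [← hn, ← Finset.sum_add_distrib]
    refine Finset.sum_congr rfl fun s _ => ?_
    rw [← mul_add, Nat.sub_add_cancel (hem s)]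
  have hzg : z ≤ g := by
    simp only [z, g, Fintype.sum_sum_type, factorDegree, Sum.elim_inl, one_mul]
    exact (Finset.sum_le_sum_of_subset (Finset.subset_univ Z)).trans (Nat.le_add_right _ _)
  have hδ : ∑ s, factorDegree r c s = r + 2 * c := by
    simp [factorDegree, mul_comm]
  let w : Ω → Fin (n + 1) → ℝ := fun ξ => normFilter n m Z ξ.1.2.1 ξ.1.2.2
  let x : ℕ → Ω → ℝ := fun i ξ => if h : i < n + 1 then
    filterLossDeriv ξ.1.1.1 ξ.1.1.2 (w ξ) (Pi.single ⟨i, h⟩ 1) else 0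
  -- Besides the entries of `X`: one scalar, `r + 2 * c` coefficients of factors, and `g` free
  -- entries of the differential.
  let gen : (Fin D × Fin N) ⊕ Unit ⊕ (Fin r ⊕ (Fin c ⊕ Fin c)) ⊕ (Fin z ⊕ Fin (g - z)) →
      (Ω → ℝ) :=
    Sum.elim (fun p ξ => ξ.1.1.1 p.1 p.2) <| Sum.elim (fun _ ξ => ξ.1.2.1) <|
      Sum.elim (fun i ξ => ξ.1.2.2 i) <|
        Sum.elim (fun i => x i) (fun i => x (n - g + z + 1 + i))
  let B := Algebra.adjoin ℝ (Set.range gen)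
  have hgen : ∀ i, gen i ∈ B := fun i => Algebra.subset_adjoin ⟨i, rfl⟩
  have hX : ∀ p : Fin D × Fin N, (fun ξ : Ω => ξ.1.1.1 p.1 p.2) ∈ B := fun p => hgen (Sum.inl p)
  have ha : (fun ξ : Ω => ξ.1.2.1) ∈ B := hgen (Sum.inr (Sum.inl ()))
  have hτ : ∀ i, (fun ξ : Ω => ξ.1.2.2 i) ∈ B := fun i => hgen (Sum.inr (Sum.inr (Sum.inl i)))
  have hw : ∀ i, (fun ξ => w ξ i) ∈ B := normFilter_mem m Z ha hτ
  have hx : ∀ i ≤ n, x i ∈ B := by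
    refine mem_of_recurrence B hzg (by omega)
      (fun i ξ => (∏ s, normPoly Z ξ.1.2.2 s ^ (m s - e s)).coeff i) x
      (prod_normPoly_mem_polyFamily Z hτ _) ?_ ?_ ?_ ?_ ?_
    · intro i hi
      funext ξ
      obtain ⟨q, hq⟩ := exists_prod_normPoly_eq Z ξ.1.2.2 (fun s => m s - e s)
      rw [hq]
      exact (coeff_X_pow_mul_one_add z q).1 i hi
    · funext ξ
      obtain ⟨q, hq⟩ := exists_prod_normPoly_eq Z ξ.1.2.2 (fun s => m s - e s)
      rw [hq]
      exact (coeff_X_pow_mul_one_add z q).2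
    · intro j hj
      funext ξ
      have h1 := ξ.2 j (by omega)
      rw [filterLossDeriv_eq_sum_range (g := g) _ _ _ (natDegree_prod_normPoly_le Z _ _)
        (by omega)] at h1
      rw [Finset.sum_apply]
      exact h1
    · exact fun i hi => hgen (Sum.inr (Sum.inr (Sum.inr (Sum.inl ⟨i, hi⟩))))
    · intro i hi hlt
      have := hgen (Sum.inr (Sum.inr (Sum.inr (Sum.inr ⟨i - (n - g + z + 1), by omega⟩))))
      simp only [gen, Sum.elim_inr] at this
      rwa [Nat.add_sub_cancel' (by omega)] at this
  have hb : ∀ t : Fin (n + 1), (fun ξ : Ω => dataVector hD ξ.1.1.1 ξ.1.1.2 t) ∈ B := by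
    intro t
    have h : (fun ξ : Ω => dataVector hD ξ.1.1.1 ξ.1.1.2 t) =
        (∑ i : Fin M, ∑ j : Fin N, (∑ t' : Fin (n + 1),
          (fun ξ : Ω => w ξ t') * (fun ξ : Ω => ξ.1.1.1 ⟨i + t', by omega⟩ j)) *
            (fun ξ : Ω => ξ.1.1.1 ⟨i + t, by omega⟩ j)) - (2⁻¹ : ℝ) • x t := by
      funext ξ
      simp only [dataVector_eq hD _ _ (w ξ), Pi.sub_apply, Finset.sum_apply, Pi.mul_apply,
        Pi.smul_apply, smul_eq_mul, x, dif_pos t.2]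
    rw [h]
    exact B.sub_mem (B.sum_mem fun i _ => B.sum_mem fun j _ => B.mul_mem
      (B.sum_mem fun t' _ => B.mul_mem (hw t') (hX (_, j))) (hX (_, j)))
      (B.smul_mem (hx t (by omega)) _)
  obtain ⟨H, hH0, hH⟩ := exists_aeval_eq_zero_of_card_lt gen
    (Sum.elim (fun (p : Fin D × Fin N) (ξ : Ω) => ξ.1.1.1 p.1 p.2)
      (fun (t : Fin (n + 1)) (ξ : Ω) => dataVector hD ξ.1.1.1 ξ.1.1.2 t))
    (by rintro (p | t); exacts [hX p, hb t])
    -- The count is `1 + (r + 2 * c) + g < n + 1`, by `hge` and the strict inequality `he`.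
    (by
      simp only [Fintype.card_sum, Fintype.card_prod, Fintype.card_fin, Fintype.card_unit]
      omega)
  obtain ⟨F, hF0, hF⟩ := forGenericData_of_relation hM hN hD H hH0
  refine ⟨F, hF0, fun X Y hXY => ?_⟩
  rintro ⟨a, τ, hdeg⟩
  refine hF X Y hXY ?_
  have := congrFun hH ⟨((X, Y), (a, τ)), hdeg⟩
  have h2 := MvPolynomial.comp_aeval_apply (R := ℝ)
    (f := (Sum.elim (fun (p : Fin D × Fin N) (ξ : Ω) => ξ.1.1.1 p.1 p.2)
      (fun (t : Fin (n + 1)) (ξ : Ω) => dataVector hD ξ.1.1.1 ξ.1.1.2 t)))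
    (Pi.evalAlgHom ℝ (fun _ : Ω => ℝ) ⟨((X, Y), (a, τ)), hdeg⟩) H
  rw [Pi.evalAlgHom_apply, this, Pi.zero_apply] at h2
  rw [h2, ← MvPolynomial.coe_aeval_eq_eval, RingHom.coe_coe]
  congr 2
  funext p
  rcases p with p | t <;> rfl

/-- The product of the finitely many exceptional polynomials works for all conditions at once. -/
lemma ForGenericData.forall {ι : Type*} [Finite ι]
    {Q : ι → Matrix (Fin D) (Fin N) ℝ → Matrix (Fin M) (Fin N) ℝ → Prop}
    (h : ∀ i, ForGenericData M D N (Q i)) : ForGenericData M D N fun X Y => ∀ i, Q i X Y := by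
  cases nonempty_fintype ι
  choose F hF0 hF using h
  refine ⟨∏ i, F i, Finset.prod_ne_zero_iff.2 fun i _ => hF0 i, fun X Y hXY i => hF i X Y ?_⟩
  rw [map_prod] at hXY
  exact Finset.prod_ne_zero_iff.1 hXY i (Finset.mem_univ i)

lemma ForGenericData.imp {p : Prop}
    {Q : Matrix (Fin D) (Fin N) ℝ → Matrix (Fin M) (Fin N) ℝ → Prop}
    (h : p → ForGenericData M D N Q) : ForGenericData M D N fun X Y => p → Q X Y := by
  by_cases hp : p
  · obtain ⟨F, hF0, hF⟩ := h hp
    exact ⟨F, hF0, fun X Y hXY _ => hF X Y hXY⟩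
  · exact ⟨1, one_ne_zero, fun X Y _ h => absurd h hp⟩

end Generic

/-! ### Normalization of the factors -/

section Normalization

open MvPolynomial

variable {r c : ℕ}

lemma not_isUnit_of_eval_zero {P : MvPolynomial (Fin 2) ℝ} (h : eval (0 : Fin 2 → ℝ) P = 0) :
    ¬ IsUnit P := by
  intro hu
  have := hu.map (eval (0 : Fin 2 → ℝ))
  rw [h] at this
  exact not_isUnit_zero this

/-- Up to scalars, the dehomogenizations of coprime irreducible factors are normalized. -/
lemma IsFactorFamily.exists_normPoly {E : Fin r ⊕ Fin c → MvPolynomial (Fin 2) ℝ}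
    (hE : IsFactorFamily E) : ∃ (Z : Finset (Fin r)) (τ : Fin r ⊕ (Fin c ⊕ Fin c) → ℝ)
      (u : Fin r ⊕ Fin c → ℝ), (∀ s, u s ≠ 0) ∧
      ∀ s, dehom (E s) = Polynomial.C (u s) * normPoly Z τ s := by
  classical
  have hlin : ∀ i : Fin r, ∃ (b : Prop) (u t : ℝ), u ≠ 0 ∧ dehom (E (Sum.inl i)) =
      Polynomial.C u * if b then Polynomial.X else 1 + Polynomial.C t * Polynomial.X := by
    intro i
    obtain ⟨α, β, h⟩ := exists_linear_coeff (hE.isHomogeneous (Sum.inl i))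
    by_cases hα : α = 0
    · refine ⟨True, β, 0, ?_, by simp [h, hα]⟩
      rintro rfl
      exact (hE.irreducible (Sum.inl i)).ne_zero (by simp [h, hα])
    · refine ⟨False, α, β / α, hα, ?_⟩
      rw [h, if_neg not_false, mul_add, ← mul_assoc, ← Polynomial.C_mul, mul_div_cancel₀ _ hα]
      simp
  have hquad : ∀ j : Fin c, ∃ u t t' : ℝ, u ≠ 0 ∧ dehom (E (Sum.inr j)) =
      Polynomial.C u * (1 + Polynomial.C t * Polynomial.X + Polynomial.C t' * Polynomial.X ^ 2) := by
    intro j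
    obtain ⟨α, β, δ, h⟩ := exists_quadratic_coeff (hE.isHomogeneous (Sum.inr j))
    -- Otherwise `y` divides the quadratic form, with a cofactor that vanishes at the origin and so
    -- is no unit.
    have hα : α ≠ 0 := by
      rintro rfl
      have h' : E (Sum.inr j) = X 1 * (C β * X 0 + C δ * X 1) := by
        rw [h, map_zero]
        ring
      rcases (hE.irreducible (Sum.inr j)).isUnit_or_isUnit h' with hu | hu
      · exact not_isUnit_of_eval_zero (by simp) hu
      · exact not_isUnit_of_eval_zero (by simp) hu
    refine ⟨α, β / α, δ / α, hα, ?_⟩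
    rw [h, mul_add, mul_add, ← mul_assoc (Polynomial.C α), ← mul_assoc (Polynomial.C α),
      ← Polynomial.C_mul, ← Polynomial.C_mul, mul_div_cancel₀ _ hα, mul_div_cancel₀ _ hα]
    simp
  choose b u t hu hb using hlin
  choose u' t' t'' hu' hb' using hquad
  refine ⟨Finset.univ.filter b, Sum.elim t (Sum.elim t' t''), Sum.elim u u', ?_, ?_⟩
  · rintro (i | j)
    · exact hu i
    · exact hu' j
  · rintro (i | j)
    · simp [normPoly, hb]
    · simp [normPoly, hb']

lemma IsFactorFamily.C_mul {E : Fin r ⊕ Fin c → MvPolynomial (Fin 2) ℝ} (hE : IsFactorFamily E)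
    {u : Fin r ⊕ Fin c → ℝ} (hu : ∀ s, u s ≠ 0) : IsFactorFamily fun s => C (u s) * E s := by
  have hunit : ∀ s, IsUnit (C (u s) : MvPolynomial (Fin 2) ℝ) := fun s =>
    isUnit_iff_exists_C.2 ⟨u s, hu s, rfl⟩
  refine ⟨fun s => (hE.isHomogeneous s).C_mul _, fun s =>
    (irreducible_isUnit_mul (hunit s)).2 (hE.irreducible s), fun s t hst => ?_⟩
  rw [isRelPrime_mul_unit_left_left (hunit s), isRelPrime_mul_unit_left_right (hunit t)]
  exact hE.isRelPrime s t hst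

/-- The scalars of the factors are absorbed into `a`, so that only `r + 2 * c` coefficients and one
scalar remain for the parameter count. -/
lemma HasRrmp.exists_normalized {ρ : Fin r → ℕ} {γ : Fin c → ℕ} {P : MvPolynomial (Fin 2) ℝ}
    (h : HasRrmp ρ γ P) : ∃ (a : ℝ) (E : Fin r ⊕ Fin c → MvPolynomial (Fin 2) ℝ)
      (Z : Finset (Fin r)) (τ : Fin r ⊕ (Fin c ⊕ Fin c) → ℝ), a ≠ 0 ∧ IsFactorFamily E ∧
      P = C a * ∏ s, E s ^ Sum.elim ρ γ s ∧ ∀ s, dehom (E s) = normPoly Z τ s := by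
  obtain ⟨a, E, ha, hE, rfl⟩ := h.exists_isFactorFamily
  obtain ⟨Z, τ, u, hu, hEu⟩ := hE.exists_normPoly
  refine ⟨a * ∏ s, u s ^ Sum.elim ρ γ s, fun s => C (u s)⁻¹ * E s, Z, τ,
    mul_ne_zero ha (Finset.prod_ne_zero_iff.2 fun s _ => pow_ne_zero _ (hu s)),
    hE.C_mul fun s => inv_ne_zero (hu s), ?_, fun s => ?_⟩
  · rw [C_mul, map_prod, mul_assoc, ← Finset.prod_mul_distrib]
    congr 1
    refine Finset.prod_congr rfl fun s _ => ?_
    rw [map_pow, ← mul_pow, ← mul_assoc, ← C_mul, mul_inv_cancel₀ (hu s), C_1, one_mul]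
  · rw [map_mul, dehom_C, hEu, ← mul_assoc, ← Polynomial.C_mul, inv_mul_cancel₀ (hu s),
      Polynomial.C_1, one_mul]

end Normalization

/-! ### From critical parameters over incompatible patterns to degenerate configurations -/

section Noncompatible

open MvPolynomial

variable {L N r c : ℕ}

/-- The first row already displays the whole filter, since `K ≤ n`. -/
lemma convMatrix_injective {m n K : ℕ} (hm : 1 ≤ m) (hK : K ≤ n) {w w' : Fin K → ℝ}
    (h : (convMatrix w : Matrix (Fin m) (Fin n) ℝ) = convMatrix w') : w = w' := by
  funext t
  have := congrFun (congrFun h ⟨0, hm⟩) ⟨t, by omega⟩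
  simpa [convMatrix_apply, coeff_dehom_formOf] using this

/-- A critical parameter over a form with a non-compatible pattern gives a degenerate
configuration. -/
lemma exists_isDegenerate_of_not_compatible {d : Fin (L + 1) → ℕ} {k : Fin L → ℕ}
    (hk : ∀ l, 1 ≤ k l) (hd : ∀ l : Fin L, d l.succ + k l = d l.castSucc + 1)
    (hdL : 1 ≤ d (Fin.last L))
    {X : Matrix (Fin (d 0)) (Fin N) ℝ} {Y : Matrix (Fin (d (Fin.last L))) (Fin N) ℝ}
    {ρ : Fin r → ℕ} {γ : Fin c → ℕ} (hρ : ∀ i, 1 ≤ ρ i) (hγ : ∀ j, 1 ≤ γ j)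
    (hcomp : ¬ Compatible k ρ γ) {w : Fin (endDegree k + 1) → ℝ} (hP : HasRrmp ρ γ (filterPoly w)) {θ : Params k}
    (hθw : paramMap d k θ = convMatrix w) (hθ : IsCritical (paramLoss d k X Y) θ) :
    ∃ s₀ Z a τ, 2 ≤ Sum.elim ρ γ s₀ ∧
      IsDegenerate X Y (endDegree k) (Sum.elim ρ γ) (fun s => if s = s₀ then 2 else 1) Z a τ := by
  have hdim := dim_eq d k hk hd
  have hend : endFilter k θ = w := by
    rw [paramMap_eq d k hk hd] at hθw
    exact convMatrix_injective hdL (by omega) hθw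
  obtain ⟨a, E, Z, τ, ha, hE, hwE, hEτ⟩ := hP.exists_normalized
  have hprod : ∏ l, formOf (k l) (θ l) = C a * ∏ s, E s ^ Sum.elim ρ γ s := by
    rw [← formOf_endFilter, hend, ← filterPoly_eq, hwE]
  obtain ⟨s₀, l₀, hs₀⟩ := exists_sq_dvd_of_not_compatible hcomp ha hE
    (fun l => isHomogeneous_formOf (k l) (θ l)) hprod
  have hm : ∀ s, 1 ≤ Sum.elim ρ γ s := by
    rintro (i | j)
    · exact hρ i
    · exact hγ j
  have hwn : normFilter (endDegree k) (Sum.elim ρ γ) Z a τ = w := by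
    rw [← coeffs_formOf (endDegree k + 1) w, ← filterPoly_eq, hwE]
    funext i
    rw [coeffs_apply, map_mul, map_prod, dehom_C, normFilter]
    simp only [map_pow, hEτ]
  have key := fun Q hQ => filterLossDeriv_eq_zero_of_sq_dvd hk hd hθ ha hE hm hprod hs₀ (Q := Q) hQ
  refine ⟨s₀, Z, a, τ, (key 0 (isHomogeneous_zero _ _ _)).1, fun j hj => ?_⟩
  -- The test form `x ^ (… - j) * y ^ j` dehomogenizes to the monomial `X ^ j` of `IsDegenerate`.
  have h1 := (key (MvPolynomial.X 0 ^ ((∑ s, factorDegree r c s * if s = s₀ then 2 else 1) - j) *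
      MvPolynomial.X 1 ^ j) (by
    have := (isHomogeneous_X_pow (R := ℝ) (0 : Fin 2)
      ((∑ s, factorDegree r c s * if s = s₀ then 2 else 1) - j)).mul
      (isHomogeneous_X_pow (R := ℝ) (1 : Fin 2) j)
    rwa [Nat.sub_add_cancel hj] at this)).2
  rw [hend] at h1
  rw [hwn, ← h1]
  congr 1
  funext i
  rw [coeffs_apply, map_mul, map_mul, map_prod]
  simp only [map_pow, hEτ, dehom_X_zero, dehom_X_one, one_pow, one_mul]

end Noncompatible

end LCN

/-! ### The main theorem -/

theorem mainTheorem5 {L : ℕ} (hL : 0 < L) (d : Fin (L + 1) → ℕ) (k : Fin L → ℕ)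
    (hk : ∀ l, 1 ≤ k l) (hd : ∀ l : Fin L, d l.succ + k l = d l.castSucc + 1)
    (hdL : 1 ≤ d (Fin.last L)) (N : ℕ) (hN : d 0 ≤ N) :
    LCN.ForGenericData (d (Fin.last L)) (d 0) N fun X Y =>
      ∀ (r c : ℕ) (ρ : Fin r → ℕ) (γ : Fin c → ℕ),
        (∀ i, 1 ≤ ρ i) → (∀ j, 1 ≤ γ j) →
        ∑ i, LCN.patternPartition ρ γ i = LCN.endDegree k →
        (LCN.Compatible k ρ γ →
          ∀ w : Fin (LCN.endDegree k + 1) → ℝ,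
            w ∈ LCN.critOn (LCN.filterLoss X Y)
              (LCN.filterPoly ⁻¹' LCN.multipleRootLocus (LCN.patternPartition ρ γ)) →
            LCN.HasRrmp ρ γ (LCN.filterPoly w) →
            ∃ θ : LCN.Params k, LCN.paramMap d k θ = LCN.convMatrix w ∧
              LCN.IsCritical (LCN.paramLoss d k X Y) θ) ∧
        (¬ LCN.Compatible k ρ γ →
          ∀ w : Fin (LCN.endDegree k + 1) → ℝ,
            w ∈ LCN.critOn (LCN.filterLoss X Y)
              (LCN.filterPoly ⁻¹' LCN.multipleRootLocus (LCN.patternPartition ρ γ)) →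
            LCN.HasRrmp ρ γ (LCN.filterPoly w) →
            ¬ ∃ θ : LCN.Params k, LCN.paramMap d k θ = LCN.convMatrix w ∧
              LCN.IsCritical (LCN.paramLoss d k X Y) θ) := by
  classical
  -- A pattern of total degree `endDegree k` has all its lengths and entries bounded by this degree.
  -- Ranging over `Fin (endDegree k + 1)` thus leaves finitely many conditions, and one polynomial
  -- serves all patterns.
  have hgen : LCN.ForGenericData (d (Fin.last L)) (d 0) N fun X Y =>
      ∀ (r c : Fin (LCN.endDegree k + 1)) (ρ : Fin r → Fin (LCN.endDegree k + 1))
        (γ : Fin c → Fin (LCN.endDegree k + 1)) (s₀ : Fin r ⊕ Fin c) (Z : Finset (Fin r)),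
        ((∀ s, 1 ≤ Sum.elim (fun i => (ρ i : ℕ)) (fun j => (γ j : ℕ)) s) ∧
          2 ≤ Sum.elim (fun i => (ρ i : ℕ)) (fun j => (γ j : ℕ)) s₀ ∧
          ∑ s, LCN.factorDegree r c s *
            Sum.elim (fun i => (ρ i : ℕ)) (fun j => (γ j : ℕ)) s = LCN.endDegree k) →
        ¬ ∃ a τ, LCN.IsDegenerate X Y (LCN.endDegree k)
          (Sum.elim (fun i => (ρ i : ℕ)) (fun j => (γ j : ℕ)))
          (fun s => if s = s₀ then 2 else 1) Z a τ := by
    refine .forall fun r => .forall fun c => .forall fun ρ => .forall fun γ => .forall fun s₀ =>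
      .forall fun Z => .imp ?_
    rintro ⟨h1, h2, h3⟩
    refine LCN.forGenericData_not_isDegenerate hdL hN (LCN.dim_eq d k hk hd) _ _ ?_ h3 ?_ Z
    · intro s
      split_ifs with hs
      · rwa [hs]
      · exact h1 s
    -- The strict inequality of the parameter count comes from the doubled exponent at `s₀`.
    · refine Finset.sum_lt_sum (fun s _ => Nat.le_mul_of_pos_right _ (by split_ifs <;> omega))
        ⟨s₀, Finset.mem_univ _, ?_⟩
      rcases s₀ with i | j <;> simp [LCN.factorDegree]
  obtain ⟨F, hF0, hF⟩ := hgen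
  refine ⟨F, hF0, fun X Y hXY r c ρ γ hρ hγ hn => ⟨fun hcomp w hw hP =>
    LCN.exists_critical_of_compatible hL d k hk hd X Y hρ hγ hn hcomp hw hP, ?_⟩⟩
  rintro hcomp w - hP ⟨θ, hθw, hθ⟩
  obtain ⟨s₀, Z, a, τ, hs₀, hdeg⟩ :=
    LCN.exists_isDegenerate_of_not_compatible hk hd hdL hρ hγ hcomp hP hθw hθ
  have hn' := hn
  simp only [LCN.patternPartition, Fintype.sum_sum_type, Sum.elim_inl, Sum.elim_inr] at hn'
  have hρle : ∀ i, ρ i ≤ ∑ i, ρ i := fun i =>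
    Finset.single_le_sum (fun _ _ => Nat.zero_le _) (Finset.mem_univ i)
  have hγle : ∀ j, γ j ≤ ∑ j, γ j := fun j =>
    Finset.single_le_sum (fun _ _ => Nat.zero_le _) (Finset.mem_univ j)
  have hr : r ≤ ∑ i, ρ i := by
    simpa using Finset.card_nsmul_le_sum Finset.univ ρ 1 fun i _ => hρ i
  have hc : c ≤ ∑ j, γ j := by
    simpa using Finset.card_nsmul_le_sum Finset.univ γ 1 fun j _ => hγ j
  refine hF X Y hXY ⟨r, by omega⟩ ⟨c, by omega⟩
    (fun i => ⟨ρ i, by have := hρle i; omega⟩) (fun j => ⟨γ j, by have := hγle j; omega⟩) s₀ Z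
    ⟨?_, hs₀, ?_⟩ ⟨a, τ, hdeg⟩
  · rintro (i | j)
    · exact hρ i
    · exact hγ j
  · exact (LCN.sum_patternPartition ρ γ).symm.trans hn
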